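/- **Algorithm.** Let $f$ be real analytic at $0$ with Taylor series starting as $x+\sum_{m=1}^{7}a_m x^{m\tau+1}$ (all further exponents $\ge 8\tau+1$), where $\tau\ge1$ is an integer and $a_1<0$. Put $\lambda=-1/(\tau a_1)$, $(-t)_k=\prod_{i=0}^{k-1}(-t-i)$, and for a sequence $v_1,v_2,\dots$ let $$S_{w,r}(v)=\sum\frac{r!}{n_1!\cdots n_w!}v_1^{n_1}\cdots v_w^{n_w},$$ the sum being over nonnegative integers with $n_1+2n_2+\cdots+wn_w=w$ and $n_1+\cdots+n_w=r$. Define, with $\beta=(1,b_1,b_2,\dots)$, $$b_j=\lambda^{j+1}\sum_{s=0}^{j}\frac{(-\tau)_{j+1-s}}{(j+1-s)!}S_{j+1,j+1-s}(a),\qquad a_{0,j}=\sum_{s=0}^{j-1}\frac{(-1)^{j-1-s}}{j-s}S_{j,j-s}(\beta),$$ $$a_{i,j}=\sum_{s=0}^{j-i-1}\frac{(-i)_{j-i-s}}{(j-i-s)!}S_{j-i,j-i-s}(\beta)\ (1\le i<j),\qquad c_0=-b_1,\quad c_i=\frac1i\Big(b_{i+1}+\sum_{h=0}^{i-1}a_{h,i+1}c_h\Big),$$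 and polynomials $T_1=X$, $P_0=1$, and $$T_{m+1}=b_1\sum_{s=0}^{m-1}\frac{(-1)^{m-1-s}}{m-s}S_{m,m-s}(T)-c_m-\sum_{p=1}^{m-1}c_p\sum_{q=1}^{m-p}\frac{(-p)_q}{q!}S_{m-p,q}(T)\quad(m\ge1),$$ $$P_m=\sum_{s=0}^{m-1}\frac{(-1/\tau)_{m-s}}{(m-s)!}S_{m,m-s}(\widetilde T),\quad \widetilde T_m(X)=T_m(-\tau X)\quad(m\ge1).$$ Formula (A) with $M$ terms and constant $C$ for a sequence $(x_n)$ means $$x_n=\Big(\frac{\lambda}{n}\Big)^{1/\tau}\Big\{1+\sum_{m=1}^{M}P_m\Big(-\frac1\tau[b_1\ln n+C]\Big)\frac1{n^m}\Big\}+O\Big(n^{-1/\tau}\Big(\frac{\ln n}{n}\Big)^{M+1}\Big)\quad(n\to\infty);$$ formula (B) is the same with $C$ replaced by $-C$. Call two functions $f,g$ *kindred* if for some common $\tau$ they have Taylor series as above, with coefficients $a_m$, $a_m'$ ($a_1,a_1'<0$) and derived data (primed for $g$) that satisfy $\lambda'=\lambda$, $c_i'=(-1)^{i+1}c_i$ for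 $1\le i\le5$, and for $1\le m\le6$: $T_m'(X)=(-1)^mT_m(-X)$, $P_m'(X)=(-1)^mP_m(-X)$, and $P_m'(-\frac1\tau[b_1'L-K])=(-1)^mP_m(-\frac1\tau[b_1L+K])$ as polynomials in $L,K$ (so that, disregarding signs, all corresponding coefficients are equal). **Theorem.** Let $Z(x)=x\exp(-x)$ and let $W$ be the principal branch of the Lambert function, $W(x)\exp(W(x))=x$, $W\ge-1$. 1. $Z$ has a Taylor series as above with $\tau=1$, $a_m=(-1)^m/m!$. Its data are $\lambda=1$; $b_j=1/(j+1)!$ for $1\le j\le6$; $a_{0,1}=1$ and $a_{0,j}=0$ for $2\le j\le6$; $(c_1,\dots,c_5)=(\frac16,\frac1{16},\frac{19}{540},\frac1{48},\frac{41}{4200})$; $T_1=X$, $T_2=\frac12X-\frac16$, $T_3=-\frac14X^2+\frac5{12}X-\frac7{48}$, $T_4=\frac16X^3-\frac{13}{24}X^2+\frac12X-\frac{587}{4320}$; $P_1=X$, $P_2=X^2+\frac12X+\frac16$, $P_3=X^3+\frac54X^2+\frac34X+\frac7{48}$, $P_4=X^4+\frac{13}6X^3+\frac{17}8X^2+\frac{23}{24}X+\frac{707}{4320}$.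 2. For every $x_0>0$ there is a constant $C=C(x_0)$ such that the sequence $x_n=Z(x_{n-1})$, $n\ge1$, satisfies formula (A) with $M=4$, and, with the same $C$, $$x_n=\frac1n-\frac{B_1}{n^2}+\frac{B_2}{n^3}-\frac{B_3}{n^4}+\frac{B_4}{n^5}+O\Big(\frac{\ln(n)^5}{n^6}\Big),$$ where $B_1=\frac12\ln n+C$, $\;B_2=\frac14\ln(n)^2+(C-\frac14)\ln n+C^2-\frac12C+\frac16$, $$B_3=\tfrac18\ln(n)^3+\big(\tfrac34C-\tfrac5{16}\big)\ln(n)^2+\big(\tfrac32C^2-\tfrac54C+\tfrac38\big)\ln n+C^3-\tfrac54C^2+\tfrac34C-\tfrac7{48},$$ $$B_4=\tfrac1{16}\ln(n)^4+\big(\tfrac12C-\tfrac{13}{48}\big)\ln(n)^3+\big(\tfrac32C^2-\tfrac{13}8C+\tfrac{17}{32}\big)\ln(n)^2+\big(2C^3-\tfrac{13}4C^2+\tfrac{17}8C-\tfrac{23}{48}\big)\ln n+C^4-\tfrac{13}6C^3+\tfrac{17}8C^2-\tfrac{23}{24}C+\tfrac{707}{4320}.$$ 3. $W$ has a Taylor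 series as above with $\tau=1$, $a_m=(-(m+1))^m/(m+1)!$, and $W$ and $Z$ are kindred. Moreover $c_1,\dots,c_5$ are positive for $Z$, and $c_1,\dots,c_5$ alternate in sign for $W$; for $2\le m\le6$ the coefficients of $T_m$ alternate in sign for $Z$ and are nonzero of one sign for $W$, and the coefficients of $P_m$ are positive for $Z$ and alternate in sign for $W$. For every $x_0>0$ there is a constant $C=C(x_0)$ such that the sequence $x_n=W(x_{n-1})$ satisfies formula (B) with $M=4$, and, with this $C$, $$x_n=\frac1n+\frac{B_1}{n^2}+\frac{B_2}{n^3}+\frac{B_3}{n^4}+\frac{B_4}{n^5}+O\Big(\frac{\ln(n)^5}{n^6}\Big).$$ -/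

import Mathlib

open Polynomial Asymptotics Filter

noncomputable section

namespace IterAsymp

/-- Sum over all tuples of nonnegative integers `n₁, …, n_w` with `n₁ + 2 n₂ + ⋯ + w n_w = w` and
`n₁ + ⋯ + n_w = r` of the multinomial coefficient `(r; n₁, …, n_w)` times
`v₁ ^ n₁ ⋯ v_w ^ n_w`, where `v_{i+1}` is stored as `v i`. The first equation forces
`n_i ≤ w / i`, and it forces any further variable `n_i` with `i > w` to vanish. -/
def multSum {R : Type*} [CommRing R] (w : ℕ) (v : Fin w → R) (r : ℕ) : R :=
  ∑ n ∈ (Fintype.piFinset fun i : Fin w => Finset.range (w / (i.val + 1) + 1)).filter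
      (fun n => ∑ i, (i.val + 1) * n i = w ∧ ∑ i, n i = r),
    (Nat.multinomial Finset.univ n : R) * ∏ i, v i ^ n i

/-- `(-t)_k = (-t)(-t-1)⋯(-t-k+1)`. -/
def fall (t : ℝ) (k : ℕ) : ℝ := ∏ i ∈ Finset.range k, (-t - (i : ℝ))

/-- `f` is analytic at the origin and its Taylor series there starts as
`x + ∑_{m=1}^{7} a_m x^{mτ+1}`, all later exponents being at least `8τ+1`. -/
def HasTaylorStart (f : ℝ → ℝ) (τ : ℕ) (a : ℕ → ℝ) : Prop :=
  AnalyticAt ℝ f 0 ∧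
    (fun x : ℝ => f x - (x + ∑ m ∈ Finset.Icc 1 7, a m * x ^ (m * τ + 1)))
      =O[nhds 0] fun x : ℝ => x ^ (8 * τ + 1)

/-- `λ = -1 / (τ a₁)`. -/
def lam (τ : ℕ) (a : ℕ → ℝ) : ℝ := -1 / ((τ : ℝ) * a 1)

/-- The coefficients `b_j`. -/
def bCoef (τ : ℕ) (a : ℕ → ℝ) (j : ℕ) : ℝ :=
  lam τ a ^ (j + 1) * ∑ s ∈ Finset.range (j + 1),
    fall τ (j + 1 - s) / ((j + 1 - s).factorial : ℝ) *
      multSum (j + 1) (fun i => a (i.val + 1)) (j + 1 - s)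

/-- The sequence `1, b₁, b₂, …`. -/
def oneB (τ : ℕ) (a : ℕ → ℝ) (i : ℕ) : ℝ := if i = 0 then 1 else bCoef τ a i

/-- The coefficients `a_{i,j}` for `0 ≤ i < j`. -/
def aCoef (τ : ℕ) (a : ℕ → ℝ) (i j : ℕ) : ℝ :=
  if i = 0 then
    ∑ s ∈ Finset.range j, (-1 : ℝ) ^ (j - 1 - s) / ((j - s : ℕ) : ℝ) *
      multSum j (fun k => oneB τ a k.val) (j - s)
  else
    ∑ s ∈ Finset.range (j - i), fall i (j - i - s) / ((j - i - s).factorial : ℝ) *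
      multSum (j - i) (fun k => oneB τ a k.val) (j - i - s)

/-- The coefficients `c₀ = -b₁` and
`c_i = (b_{i+1} + ∑_{h=0}^{i-1} a_{h,i+1} c_h) / i` for `i ≥ 1`. -/
def cCoef (τ : ℕ) (a : ℕ → ℝ) : ℕ → ℝ
  | 0 => -bCoef τ a 1
  | i + 1 => 1 / ((i : ℝ) + 1) *
      (bCoef τ a (i + 2) + ∑ h : Fin (i + 1), aCoef τ a h.val (i + 2) * cCoef τ a h.val)
  termination_by i => i
  decreasing_by exact h.isLt

/-- The polynomials `T_m`, with `T₁ = X`; the case `m = 0` is not used. -/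
def T (τ : ℕ) (a : ℕ → ℝ) : ℕ → ℝ[X]
  | 0 => 0
  | 1 => X
  | m + 2 =>
      C (bCoef τ a 1) * ∑ s ∈ Finset.range (m + 1),
          C ((-1 : ℝ) ^ (m - s) / ((m + 1 - s : ℕ) : ℝ)) *
            multSum (m + 1) (fun i => T τ a (i.val + 1)) (m + 1 - s)
        - C (cCoef τ a (m + 1))
        - ∑ p ∈ Finset.Icc 1 m, C (cCoef τ a p) * ∑ q ∈ Finset.Icc 1 (m + 1 - p),
            C (fall p q / (q.factorial : ℝ)) *
              multSum (m + 1 - p) (fun i => T τ a (i.val + 1)) q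
  termination_by m => m
  decreasing_by
    · have := i.isLt; omega
    · have := i.isLt; omega

/-- `P₀ = 1`, and `P_m` for `m ≥ 1` in terms of the polynomials `T_i(-τX)`. -/
def P (τ : ℕ) (a : ℕ → ℝ) (m : ℕ) : ℝ[X] :=
  if m = 0 then 1 else
    ∑ s ∈ Finset.range m,
      C (fall (1 / (τ : ℝ)) (m - s) / ((m - s).factorial : ℝ)) *
        multSum m (fun i => (T τ a (i.val + 1)).comp (C (-(τ : ℝ)) * X)) (m - s)

/-- The expansion
`x_n ∼ (λ/n)^{1/τ} {1 + ∑_{m=1}^{M} P_m(-(1/τ)[b₁ ln n + K]) / n^m}`,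
with an error of the order of magnitude of the first omitted block. -/
def Expansion (τ : ℕ) (a : ℕ → ℝ) (M : ℕ) (x : ℕ → ℝ) (K : ℝ) : Prop :=
  (fun n : ℕ => x n - (lam τ a / (n : ℝ)) ^ (1 / (τ : ℝ)) *
      (1 + ∑ m ∈ Finset.Icc 1 M,
        (P τ a m).eval (-(1 / (τ : ℝ)) * (bCoef τ a 1 * Real.log n + K)) / (n : ℝ) ^ m))
    =O[atTop] fun n : ℕ =>
      ((n : ℝ) ^ (1 / (τ : ℝ)))⁻¹ * (Real.log n / (n : ℝ)) ^ (M + 1)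

/-- `P_m(-(1/τ)[b₁ L + σ K])` as a polynomial in the two variables `L` (index `0`) and `K`
(index `1`). -/
def block (τ : ℕ) (a : ℕ → ℝ) (σ : ℝ) (m : ℕ) : MvPolynomial (Fin 2) ℝ :=
  Polynomial.aeval
    (MvPolynomial.C (-(1 / (τ : ℝ))) *
      (MvPolynomial.C (bCoef τ a 1) * MvPolynomial.X 0 +
        MvPolynomial.C σ * MvPolynomial.X 1)) (P τ a m)

/-- Kindred functions: disregarding signs, all corresponding coefficients of the data
`c_i`, `T_m`, `P_m` and of the blocks of the two iteration expansions are equal, and the signs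
are related as follows. The `c_i`, the coefficients of `T_m` and those of `P_m` for one function
arise from those for the other by an alternating change of signs, and so do the successive blocks
of the expansions when the constant of one of them is written as `-K`. -/
def Kindred (f g : ℝ → ℝ) : Prop :=
  ∃ (τ : ℕ) (a a' : ℕ → ℝ), 1 ≤ τ ∧ a 1 < 0 ∧ a' 1 < 0 ∧
    HasTaylorStart f τ a ∧ HasTaylorStart g τ a' ∧
    lam τ a' = lam τ a ∧
    (∀ i ∈ Finset.Icc 1 5, cCoef τ a' i = (-1) ^ (i + 1) * cCoef τ a i) ∧
    (∀ m ∈ Finset.Icc 1 6, T τ a' m = (-1) ^ m * (T τ a m).comp (-X)) ∧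
    (∀ m ∈ Finset.Icc 1 6, P τ a' m = (-1) ^ m * (P τ a m).comp (-X)) ∧
    (∀ m ∈ Finset.Icc 1 6, block τ a' (-1) m = (-1) ^ m * block τ a 1 m)

/-- All coefficients up to the degree are positive. -/
def PosCoeffs (p : ℝ[X]) : Prop := ∀ k ≤ p.natDegree, 0 < p.coeff k

/-- All coefficients up to the degree are nonzero and have the same sign. -/
def SameSignCoeffs (p : ℝ[X]) : Prop :=
  ∀ k ≤ p.natDegree, ∀ l ≤ p.natDegree, 0 < p.coeff k * p.coeff l

/-- Neighbouring coefficients up to the degree have opposite signs. -/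
def AltCoeffs (p : ℝ[X]) : Prop := ∀ k < p.natDegree, p.coeff k * p.coeff (k + 1) < 0

/-- `Z(x) = x exp(-x)`. -/
def Z (x : ℝ) : ℝ := x * Real.exp (-x)

/-- The principal branch of the Lambert function: for `x ≥ -1/e`, the number `w ≥ -1` with
`w exp w = x`. -/
def lambertW : ℝ → ℝ := Function.invFunOn (fun w : ℝ => w * Real.exp w) (Set.Ici (-1))

/-- Taylor coefficients of `Z`: `a_m = (-1)^m / m!`, the coefficient of `x^{m+1}`. -/
def aZ (m : ℕ) : ℝ := (-1) ^ m / (m.factorial : ℝ)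

/-- Taylor coefficients of `W`: `a_m = (-(m+1))^m / (m+1)!`, the coefficient of `x^{m+1}`. -/
def aW (m : ℕ) : ℝ := (-((m : ℝ) + 1)) ^ m / ((m + 1).factorial : ℝ)

end IterAsymp

end

/-! The coefficients are finite computations; the asymptotics come from a truncated solution of
Abel's equation.

Coefficients. By the multinomial theorem each sum S_{w,r}(v) is the coefficient of x^w in (v_1 x +
v_2 x^2 + ...)^r (`multSum_eq_powCoeff`). A recursion on r makes these coefficients computable, so
b_j, a_{i,j}, c_i and the values of T_m and P_m follow in order for both functions. Kinship and the
sign patterns are then read off from the resulting tables. The structural reason for the kinship is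
that the inverse of W near 0 is x exp(x) = -Z(-x): up to the reflection x -> -x, W is the inverse of
Z.

Asymptotics. The function `abelFun` increases by 1 + O(s^5) when s is replaced by Z(s)
(`abelFun_Z_sub_isBigO`). This holds on both sides of 0, because the real logarithm is log|s|.
Positive orbits of Z move forward along this relation. For an orbit x_n of W, the points -x_n
satisfy Z(-x_{n+1}) = -x_n, so they move backward along it on the negative side. Since s_n = O(1/n),
summing the increments gives abelFun(s_n) = σn + K + O(n^{-4}) with σ = 1 for Z and σ = -1 for W
(`exists_sub_isBigO_of_diff_isBigO`).

Inversion. Put e = σ/n and u = -(ln n/2 + K)e. The approximant e(1 + `homSum` u e), built from P_1,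
..., P_4 of Z, satisfies e(abelFun - σn - K) = O(‖(u,e)‖^5) (`homSum_equation_isBigO`). The dominant
term 1/s makes `abelFun` expand distances: |s - t| ≤ 2|s||t||abelFun s - abelFun t| for small s, t
of equal sign (`abs_sub_le_abelFun`). This turns the residual into the error O((ln n)^5/n^6). Both
expansions thus come from a single statement, `sub_homSum_isBigO`. -/

namespace IterAsymp

/-! ### Multinomial sums as coefficients of powers. -/

section MultSum

variable {R : Type*} [CommRing R]

/-- The coefficient of `X ^ w` in `(v 0 * X + v 1 * X ^ 2 + ⋯) ^ r`, by recursion on `r`. -/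
def powCoeff (v : ℕ → R) : ℕ → ℕ → R
  | 0, w => if w = 0 then 1 else 0
  | r + 1, w => ∑ i ∈ Finset.range (w - r), v i * powCoeff v r (w - 1 - i)

theorem powCoeff_eq_zero (v : ℕ → R) {r w : ℕ} (h : w < r) : powCoeff v r w = 0 := by
  cases r with
  | zero => omega
  | succ r => simp [powCoeff, Nat.sub_eq_zero_of_le (Nat.lt_succ_iff.1 h)]

theorem coeff_sum_pow (v : ℕ → R) (N r : ℕ) : ∀ w ≤ N,
    ((∑ i ∈ Finset.range N, C (v i) * X ^ (i + 1) : R[X]) ^ r).coeff w = powCoeff v r w := by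
  induction r with
  | zero => intro w _; simp [powCoeff, coeff_one]
  | succ r ih =>
    intro w hw
    rw [pow_succ', Finset.sum_mul, finsetSum_coeff, powCoeff,
      -- The other r factors have weight at least r together, so only indices i < w - r contribute.
      ← Finset.sum_subset (Finset.range_subset_range.2 ((Nat.sub_le w r).trans hw))]
    · refine Finset.sum_congr rfl fun i hi => ?_
      have hi' : i + 1 ≤ w := by have := Finset.mem_range.1 hi; omega
      rw [mul_assoc, coeff_C_mul, coeff_X_pow_mul', if_pos hi', ih _ (by omega)]
      congr 2
      omega
    · intro i _ hi
      rw [mul_assoc, coeff_C_mul, coeff_X_pow_mul']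
      split_ifs with h
      · rw [ih _ (by omega), powCoeff_eq_zero, mul_zero]
        rw [Finset.mem_range] at hi
        omega
      · rw [mul_zero]

/-- This is the multinomial theorem: the r-th power supplies the condition ∑ n_i = r, and extracting
the coefficient of X^w supplies ∑ i n_i = w. -/
theorem multSum_eq_coeff (w : ℕ) (v : Fin w → R) (r : ℕ) :
    multSum w v r = ((∑ i : Fin w, C (v i) * X ^ (i.val + 1) : R[X]) ^ r).coeff w := by
  have hterm : ∀ n : Fin w → ℕ,
      ((Nat.multinomial Finset.univ n : R[X]) *
        ∏ i, (C (v i) * X ^ (i.val + 1) : R[X]) ^ n i).coeff w =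
      if ∑ i, (i.val + 1) * n i = w then
        (Nat.multinomial Finset.univ n : R) * ∏ i, v i ^ n i else 0 := by
    intro n
    have : (Nat.multinomial Finset.univ n : R[X]) *
        ∏ i, (C (v i) * X ^ (i.val + 1) : R[X]) ^ n i =
        C ((Nat.multinomial Finset.univ n : R) * ∏ i, v i ^ n i) *
          X ^ (∑ i, (i.val + 1) * n i) := by
      simp only [mul_pow, Finset.prod_mul_distrib, ← pow_mul, Finset.prod_pow_eq_pow_sum,
        map_mul, map_prod, map_pow, map_natCast, mul_assoc]
    rw [this, coeff_C_mul_X_pow]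
    exact if_congr eq_comm rfl rfl
  rw [Finset.sum_pow_eq_sum_piAntidiag, finsetSum_coeff, Finset.sum_congr rfl fun n _ => hterm n,
    ← Finset.sum_filter]
  refine Finset.sum_congr ?_ fun _ _ => rfl
  ext n
  simp only [Finset.mem_filter, Fintype.mem_piFinset, Finset.mem_range, Finset.mem_piAntidiag,
    Finset.mem_univ, implies_true, and_true]
  constructor
  · rintro ⟨_, h⟩
    exact ⟨h.2, h.1⟩
  · rintro ⟨h2, h1⟩
    refine ⟨fun i => Nat.lt_succ_of_le ((Nat.le_div_iff_mul_le (by omega)).2 ?_), h1, h2⟩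
    rw [mul_comm]
    refine le_of_le_of_eq ?_ h1
    exact Finset.single_le_sum (f := fun i : Fin w => (i.val + 1) * n i)
      (fun _ _ => Nat.zero_le _) (Finset.mem_univ i)

theorem multSum_eq_powCoeff (v : ℕ → R) (w r : ℕ) :
    multSum w (fun i => v i.val) r = powCoeff v r w := by
  rw [multSum_eq_coeff, ← coeff_sum_pow _ w r w le_rfl, Finset.sum_range]

theorem map_powCoeff {S : Type*} [CommRing S] (φ : R →+* S) (v : ℕ → R) (r w : ℕ) :
    φ (powCoeff v r w) = powCoeff (fun i => φ (v i)) r w := by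
  induction r generalizing w with
  | zero => simp [powCoeff, apply_ite φ]
  | succ r ih => simp [powCoeff, ih]

theorem powCoeff_weight_1 (v : ℕ → R) :
    powCoeff v 1 1 = v 0 := by
  simp [powCoeff]

theorem powCoeff_weight_2 (v : ℕ → R) :
    powCoeff v 1 2 = v 1 ∧
    powCoeff v 2 2 = v 0 ^ 2 := by
  refine ⟨?_, ?_⟩ <;>
    (simp only [powCoeff, Finset.sum_range_succ, Finset.sum_range_zero, Nat.reduceSub,
      Nat.reduceEqDiff, if_true, if_false]; ring)

theorem powCoeff_weight_3 (v : ℕ → R) :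
    powCoeff v 1 3 = v 2 ∧
    powCoeff v 2 3 = 2 * v 0 * v 1 ∧
    powCoeff v 3 3 = v 0 ^ 3 := by
  refine ⟨?_, ?_, ?_⟩ <;>
    (simp only [powCoeff, Finset.sum_range_succ, Finset.sum_range_zero, Nat.reduceSub,
      Nat.reduceEqDiff, if_true, if_false, OfNat.ofNat_ne_zero]; ring)

theorem powCoeff_weight_4 (v : ℕ → R) :
    powCoeff v 1 4 = v 3 ∧
    powCoeff v 2 4 = 2 * v 0 * v 2 + v 1 ^ 2 ∧
    powCoeff v 3 4 = 3 * v 0 ^ 2 * v 1 ∧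
    powCoeff v 4 4 = v 0 ^ 4 := by
  refine ⟨?_, ?_, ?_, ?_⟩ <;>
    (simp only [powCoeff, Finset.sum_range_succ, Finset.sum_range_zero, Nat.reduceSub,
      Nat.reduceEqDiff, if_true, if_false, OfNat.ofNat_ne_zero]; ring)

theorem powCoeff_weight_5 (v : ℕ → R) :
    powCoeff v 1 5 = v 4 ∧
    powCoeff v 2 5 = 2 * v 0 * v 3 + 2 * v 1 * v 2 ∧
    powCoeff v 3 5 = 3 * v 0 ^ 2 * v 2 + 3 * v 0 * v 1 ^ 2 ∧
    powCoeff v 4 5 = 4 * v 0 ^ 3 * v 1 ∧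
    powCoeff v 5 5 = v 0 ^ 5 := by
  refine ⟨?_, ?_, ?_, ?_, ?_⟩ <;>
    (simp only [powCoeff, Finset.sum_range_succ, Finset.sum_range_zero, Nat.reduceSub,
      Nat.reduceEqDiff, if_true, if_false, OfNat.ofNat_ne_zero]; ring)

theorem powCoeff_weight_6 (v : ℕ → R) :
    powCoeff v 1 6 = v 5 ∧
    powCoeff v 2 6 = 2 * v 0 * v 4 + 2 * v 1 * v 3 + v 2 ^ 2 ∧
    powCoeff v 3 6 = 3 * v 0 ^ 2 * v 3 + 6 * v 0 * v 1 * v 2 + v 1 ^ 3 ∧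
    powCoeff v 4 6 = 4 * v 0 ^ 3 * v 2 + 6 * v 0 ^ 2 * v 1 ^ 2 ∧
    powCoeff v 5 6 = 5 * v 0 ^ 4 * v 1 ∧
    powCoeff v 6 6 = v 0 ^ 6 := by
  refine ⟨?_, ?_, ?_, ?_, ?_, ?_⟩ <;>
    (simp only [powCoeff, Finset.sum_range_succ, Finset.sum_range_zero, Nat.reduceSub,
      Nat.reduceEqDiff, if_true, if_false, OfNat.ofNat_ne_zero]; ring)

theorem powCoeff_weight_7 (v : ℕ → R) :
    powCoeff v 1 7 = v 6 ∧
    powCoeff v 2 7 = 2 * v 0 * v 5 + 2 * v 1 * v 4 + 2 * v 2 * v 3 ∧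
    powCoeff v 3 7 = 3 * v 0 ^ 2 * v 4 + 6 * v 0 * v 1 * v 3 + 3 * v 0 * v 2 ^ 2 +
      3 * v 1 ^ 2 * v 2 ∧
    powCoeff v 4 7 = 4 * v 0 ^ 3 * v 3 + 12 * v 0 ^ 2 * v 1 * v 2 + 4 * v 0 * v 1 ^ 3 ∧
    powCoeff v 5 7 = 5 * v 0 ^ 4 * v 2 + 10 * v 0 ^ 3 * v 1 ^ 2 ∧
    powCoeff v 6 7 = 6 * v 0 ^ 5 * v 1 ∧
    powCoeff v 7 7 = v 0 ^ 7 := by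
  refine ⟨?_, ?_, ?_, ?_, ?_, ?_, ?_⟩ <;>
    (simp only [powCoeff, Finset.sum_range_succ, Finset.sum_range_zero, Nat.reduceSub,
      Nat.reduceEqDiff, if_true, if_false, OfNat.ofNat_ne_zero]; ring)

end MultSum

/-! ### The data of the algorithm in computable form. -/

section Coefficients

/-- The weight is a separate variable so that instances carry a literal numeral, which the tables of
`powCoeff` values can match. -/
theorem bCoef_eq (τ : ℕ) (a : ℕ → ℝ) (j w : ℕ) (hw : j + 1 = w) :
    bCoef τ a j = lam τ a ^ w * ∑ s ∈ Finset.range w,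
      fall τ (w - s) / ((w - s).factorial : ℝ) * powCoeff (fun i => a (i + 1)) (w - s) w := by
  subst hw
  simp only [bCoef, ← multSum_eq_powCoeff]

theorem aCoef_zero_eq (τ : ℕ) (a : ℕ → ℝ) (j : ℕ) :
    aCoef τ a 0 j = ∑ s ∈ Finset.range j,
      (-1 : ℝ) ^ (j - 1 - s) / ((j - s : ℕ) : ℝ) * powCoeff (oneB τ a) (j - s) j := by
  simp only [aCoef, if_true, ← multSum_eq_powCoeff]

theorem aCoef_eq (τ : ℕ) (a : ℕ → ℝ) (i j : ℕ) (hi : i ≠ 0) :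
    aCoef τ a i j = ∑ s ∈ Finset.range (j - i), fall i (j - i - s) / ((j - i - s).factorial : ℝ) *
      powCoeff (oneB τ a) (j - i - s) (j - i) := by
  simp only [aCoef, if_neg hi, ← multSum_eq_powCoeff]

theorem cCoef_eq (τ : ℕ) (a : ℕ → ℝ) (i j : ℕ) (hj : i + 1 = j) :
    cCoef τ a j = 1 / (j : ℝ) *
      (bCoef τ a (j + 1) + ∑ h ∈ Finset.range j, aCoef τ a h (j + 1) * cCoef τ a h) := by
  subst hj
  rw [cCoef, Finset.sum_range]
  push_cast
  rfl

/-- Evaluation at x is a ring homomorphism, hence commutes with `powCoeff`. The polynomial recursion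
becomes one between real numbers; polynomial identities are recovered later from equality at every
x. -/
theorem eval_T_eq (τ : ℕ) (a : ℕ → ℝ) (x : ℝ) (m w : ℕ) (hw : m + 1 = w) :
    (T τ a (w + 1)).eval x =
      bCoef τ a 1 * ∑ s ∈ Finset.range w, (-1 : ℝ) ^ (w - 1 - s) / ((w - s : ℕ) : ℝ) *
          powCoeff (fun i => (T τ a (i + 1)).eval x) (w - s) w
        - cCoef τ a w
        - ∑ p ∈ Finset.Icc 1 (w - 1), cCoef τ a p * ∑ q ∈ Finset.Icc 1 (w - p),
            fall p q / (q.factorial : ℝ) *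
              powCoeff (fun i => (T τ a (i + 1)).eval x) q (w - p) := by
  subst hw
  have h : ∀ w r, (powCoeff (fun i => T τ a (i + 1)) r w).eval x =
      powCoeff (fun i => (T τ a (i + 1)).eval x) r w :=
    fun w r => map_powCoeff (Polynomial.evalRingHom x) _ r w
  rw [T]
  simp only [multSum_eq_powCoeff (fun i => T τ a (i + 1)), eval_sub, eval_mul, eval_C,
    eval_finsetSum, h, Nat.add_sub_cancel]

theorem eval_P_eq (τ : ℕ) (a : ℕ → ℝ) (x : ℝ) (m : ℕ) (hm : m ≠ 0) :
    (P τ a m).eval x = ∑ s ∈ Finset.range m,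
      fall (1 / (τ : ℝ)) (m - s) / ((m - s).factorial : ℝ) *
        powCoeff (fun i => (T τ a (i + 1)).eval (-(τ : ℝ) * x)) (m - s) m := by
  have h : ∀ w r,
      (powCoeff (fun i => (T τ a (i + 1)).comp (C (-(τ : ℝ)) * X)) r w).eval x =
      powCoeff (fun i => (T τ a (i + 1)).eval (-(τ : ℝ) * x)) r w := by
    intro w r
    have := map_powCoeff (Polynomial.evalRingHom x)
      (fun i => (T τ a (i + 1)).comp (C (-(τ : ℝ)) * X)) r w
    simpa [eval_comp] using this
  rw [P, if_neg hm]
  simp only [multSum_eq_powCoeff (fun i => (T τ a (i + 1)).comp (C (-(τ : ℝ)) * X)), eval_mul,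
    eval_C, eval_finsetSum, h]

theorem lam_aZ : lam 1 aZ = 1 := by simp [lam, aZ]

theorem lam_aW : lam 1 aW = 1 := by norm_num [lam, aW]

theorem T_one (τ : ℕ) (a : ℕ → ℝ) : T τ a 1 = X := by rw [T]

end Coefficients

/-! ### Tables of numerical values for Z and W. -/

section Values

/-- With τ = λ = 1, b_j is the coefficient of x^{j+1} in x/f(x). For Z this quotient is exp(x),
which explains the values 1/(j+1)!. -/
theorem bCoef_aZ_1 : bCoef 1 aZ 1 = 1 / 2 := by
  rw [bCoef_eq 1 aZ 1 2 rfl]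
  norm_num [lam_aZ, Finset.sum_range_succ, fall, Finset.prod_range_succ, powCoeff_weight_2,
    aZ, Nat.factorial]

theorem bCoef_aZ_2 : bCoef 1 aZ 2 = 1 / 6 := by
  rw [bCoef_eq 1 aZ 2 3 rfl]
  norm_num [lam_aZ, Finset.sum_range_succ, fall, Finset.prod_range_succ, powCoeff_weight_3,
    aZ, Nat.factorial]

theorem bCoef_aZ_3 : bCoef 1 aZ 3 = 1 / 24 := by
  rw [bCoef_eq 1 aZ 3 4 rfl]
  norm_num [lam_aZ, Finset.sum_range_succ, fall, Finset.prod_range_succ, powCoeff_weight_4,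
    aZ, Nat.factorial]

theorem bCoef_aZ_4 : bCoef 1 aZ 4 = 1 / 120 := by
  rw [bCoef_eq 1 aZ 4 5 rfl]
  norm_num [lam_aZ, Finset.sum_range_succ, fall, Finset.prod_range_succ, powCoeff_weight_5,
    aZ, Nat.factorial]

theorem bCoef_aZ_5 : bCoef 1 aZ 5 = 1 / 720 := by
  rw [bCoef_eq 1 aZ 5 6 rfl]
  norm_num [lam_aZ, Finset.sum_range_succ, fall, Finset.prod_range_succ, powCoeff_weight_6,
    aZ, Nat.factorial]

theorem bCoef_aZ_6 : bCoef 1 aZ 6 = 1 / 5040 := by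
  rw [bCoef_eq 1 aZ 6 7 rfl]
  norm_num [lam_aZ, Finset.sum_range_succ, fall, Finset.prod_range_succ, powCoeff_weight_7,
    aZ, Nat.factorial]

/-- The numbers a_{0,j} are the coefficients of log(1 + x + b_1 x^2 + ...). For Z the argument is
exp(x), so the logarithm is x. -/
theorem aCoef_aZ_0_1 : aCoef 1 aZ 0 1 = 1 := by
  norm_num [aCoef_zero_eq, Finset.sum_range_succ, powCoeff_weight_1, oneB,
    Nat.factorial]

theorem aCoef_aZ_0_2 : aCoef 1 aZ 0 2 = 0 := by
  norm_num [aCoef_zero_eq, Finset.sum_range_succ, powCoeff_weight_2, oneB,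
    bCoef_aZ_1, Nat.factorial]

theorem aCoef_aZ_0_3 : aCoef 1 aZ 0 3 = 0 := by
  norm_num [aCoef_zero_eq, Finset.sum_range_succ, powCoeff_weight_3, oneB,
    bCoef_aZ_1, bCoef_aZ_2, Nat.factorial]

theorem aCoef_aZ_0_4 : aCoef 1 aZ 0 4 = 0 := by
  norm_num [aCoef_zero_eq, Finset.sum_range_succ, powCoeff_weight_4, oneB,
    bCoef_aZ_1, bCoef_aZ_2, bCoef_aZ_3, Nat.factorial]

theorem aCoef_aZ_0_5 : aCoef 1 aZ 0 5 = 0 := by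
  norm_num [aCoef_zero_eq, Finset.sum_range_succ, powCoeff_weight_5, oneB,
    bCoef_aZ_1, bCoef_aZ_2, bCoef_aZ_3, bCoef_aZ_4, Nat.factorial]

theorem aCoef_aZ_0_6 : aCoef 1 aZ 0 6 = 0 := by
  norm_num [aCoef_zero_eq, Finset.sum_range_succ, powCoeff_weight_6, oneB,
    bCoef_aZ_1, bCoef_aZ_2, bCoef_aZ_3, bCoef_aZ_4, bCoef_aZ_5, Nat.factorial]

theorem aCoef_aZ_1_3 : aCoef 1 aZ 1 3 = 1 / 2 := by
  rw [aCoef_eq 1 aZ 1 3 (by norm_num)]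
  norm_num [Finset.sum_range_succ, fall, Finset.prod_range_succ, powCoeff_weight_2, oneB,
    bCoef_aZ_1, Nat.factorial]

theorem aCoef_aZ_1_4 : aCoef 1 aZ 1 4 = -1 / 6 := by
  rw [aCoef_eq 1 aZ 1 4 (by norm_num)]
  norm_num [Finset.sum_range_succ, fall, Finset.prod_range_succ, powCoeff_weight_3, oneB,
    bCoef_aZ_1, bCoef_aZ_2, Nat.factorial]

theorem aCoef_aZ_1_5 : aCoef 1 aZ 1 5 = 1 / 24 := by
  rw [aCoef_eq 1 aZ 1 5 (by norm_num)]
  norm_num [Finset.sum_range_succ, fall, Finset.prod_range_succ, powCoeff_weight_4, oneB,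
    bCoef_aZ_1, bCoef_aZ_2, bCoef_aZ_3, Nat.factorial]

theorem aCoef_aZ_1_6 : aCoef 1 aZ 1 6 = -1 / 120 := by
  rw [aCoef_eq 1 aZ 1 6 (by norm_num)]
  norm_num [Finset.sum_range_succ, fall, Finset.prod_range_succ, powCoeff_weight_5, oneB,
    bCoef_aZ_1, bCoef_aZ_2, bCoef_aZ_3, bCoef_aZ_4, Nat.factorial]

theorem aCoef_aZ_2_4 : aCoef 1 aZ 2 4 = 2 := by
  rw [aCoef_eq 1 aZ 2 4 (by norm_num)]
  norm_num [Finset.sum_range_succ, fall, Finset.prod_range_succ, powCoeff_weight_2, oneB,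
    bCoef_aZ_1, Nat.factorial]

theorem aCoef_aZ_2_5 : aCoef 1 aZ 2 5 = -4 / 3 := by
  rw [aCoef_eq 1 aZ 2 5 (by norm_num)]
  norm_num [Finset.sum_range_succ, fall, Finset.prod_range_succ, powCoeff_weight_3, oneB,
    bCoef_aZ_1, bCoef_aZ_2, Nat.factorial]

theorem aCoef_aZ_2_6 : aCoef 1 aZ 2 6 = 2 / 3 := by
  rw [aCoef_eq 1 aZ 2 6 (by norm_num)]
  norm_num [Finset.sum_range_succ, fall, Finset.prod_range_succ, powCoeff_weight_4, oneB,
    bCoef_aZ_1, bCoef_aZ_2, bCoef_aZ_3, Nat.factorial]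

theorem aCoef_aZ_3_5 : aCoef 1 aZ 3 5 = 9 / 2 := by
  rw [aCoef_eq 1 aZ 3 5 (by norm_num)]
  norm_num [Finset.sum_range_succ, fall, Finset.prod_range_succ, powCoeff_weight_2, oneB,
    bCoef_aZ_1, Nat.factorial]

theorem aCoef_aZ_3_6 : aCoef 1 aZ 3 6 = -9 / 2 := by
  rw [aCoef_eq 1 aZ 3 6 (by norm_num)]
  norm_num [Finset.sum_range_succ, fall, Finset.prod_range_succ, powCoeff_weight_3, oneB,
    bCoef_aZ_1, bCoef_aZ_2, Nat.factorial]

theorem aCoef_aZ_4_6 : aCoef 1 aZ 4 6 = 8 := by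
  rw [aCoef_eq 1 aZ 4 6 (by norm_num)]
  norm_num [Finset.sum_range_succ, fall, Finset.prod_range_succ, powCoeff_weight_2, oneB,
    bCoef_aZ_1, Nat.factorial]

theorem cCoef_aZ_0 : cCoef 1 aZ 0 = -1 / 2 := by
  rw [cCoef, bCoef_aZ_1]
  norm_num

/-- The values c_1, c_2, c_3 reappear as the coefficients of s, s^2, s^3 in `abelFun`. -/
theorem cCoef_aZ_1 : cCoef 1 aZ 1 = 1 / 6 := by
  rw [cCoef_eq 1 aZ 0 1 rfl]
  norm_num [Finset.sum_range_succ, bCoef_aZ_2, aCoef_aZ_0_2, cCoef_aZ_0]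

theorem cCoef_aZ_2 : cCoef 1 aZ 2 = 1 / 16 := by
  rw [cCoef_eq 1 aZ 1 2 rfl]
  norm_num [Finset.sum_range_succ, bCoef_aZ_3, aCoef_aZ_0_3, aCoef_aZ_1_3, cCoef_aZ_0, cCoef_aZ_1]

theorem cCoef_aZ_3 : cCoef 1 aZ 3 = 19 / 540 := by
  rw [cCoef_eq 1 aZ 2 3 rfl]
  norm_num [Finset.sum_range_succ, bCoef_aZ_4, aCoef_aZ_0_4, aCoef_aZ_1_4, aCoef_aZ_2_4,
    cCoef_aZ_0, cCoef_aZ_1, cCoef_aZ_2]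

theorem cCoef_aZ_4 : cCoef 1 aZ 4 = 1 / 48 := by
  rw [cCoef_eq 1 aZ 3 4 rfl]
  norm_num [Finset.sum_range_succ, bCoef_aZ_5, aCoef_aZ_0_5, aCoef_aZ_1_5, aCoef_aZ_2_5,
    aCoef_aZ_3_5, cCoef_aZ_0, cCoef_aZ_1, cCoef_aZ_2, cCoef_aZ_3]

theorem cCoef_aZ_5 : cCoef 1 aZ 5 = 41 / 4200 := by
  rw [cCoef_eq 1 aZ 4 5 rfl]
  norm_num [Finset.sum_range_succ, bCoef_aZ_6, aCoef_aZ_0_6, aCoef_aZ_1_6, aCoef_aZ_2_6,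
    aCoef_aZ_3_6, aCoef_aZ_4_6, cCoef_aZ_0, cCoef_aZ_1, cCoef_aZ_2, cCoef_aZ_3, cCoef_aZ_4]

theorem eval_T_aZ_2 (x : ℝ) : (T 1 aZ 2).eval x = 1 / 2 * x - 1 / 6 := by
  rw [eval_T_eq 1 aZ x 0 1 rfl]
  norm_num [Finset.sum_range_succ, Finset.sum_Icc_succ_top, fall, Finset.prod_range_succ,
    Nat.factorial, powCoeff_weight_1, bCoef_aZ_1, cCoef_aZ_1, T_one]

theorem eval_T_aZ_3 (x : ℝ) : (T 1 aZ 3).eval x = -(1 / 4) * x ^ 2 + 5 / 12 * x - 7 / 48 := by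
  rw [eval_T_eq 1 aZ x 1 2 rfl]
  norm_num [Finset.sum_range_succ, Finset.sum_Icc_succ_top, fall, Finset.prod_range_succ,
    Nat.factorial, powCoeff_weight_1, powCoeff_weight_2, bCoef_aZ_1, cCoef_aZ_1, cCoef_aZ_2,
    T_one, eval_T_aZ_2]
  ring

theorem eval_T_aZ_4 (x : ℝ) : (T 1 aZ 4).eval x = 1 / 6 * x ^ 3 - 13 / 24 * x ^ 2 + 1 / 2 * x -
    587 / 4320 := by
  rw [eval_T_eq 1 aZ x 2 3 rfl]
  norm_num [Finset.sum_range_succ, Finset.sum_Icc_succ_top, fall, Finset.prod_range_succ,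
    Nat.factorial, powCoeff_weight_1, powCoeff_weight_2, powCoeff_weight_3, bCoef_aZ_1,
    cCoef_aZ_1, cCoef_aZ_2, cCoef_aZ_3, T_one, eval_T_aZ_2, eval_T_aZ_3]
  ring

theorem eval_T_aZ_5 (x : ℝ) : (T 1 aZ 5).eval x = -(1 / 8) * x ^ 4 + 5 / 8 * x ^ 3 -
    49 / 48 * x ^ 2 + 947 / 1440 * x - 1217 / 8640 := by
  rw [eval_T_eq 1 aZ x 3 4 rfl]
  norm_num [Finset.sum_range_succ, Finset.sum_Icc_succ_top, fall, Finset.prod_range_succ,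
    Nat.factorial, powCoeff_weight_1, powCoeff_weight_2, powCoeff_weight_3, powCoeff_weight_4,
    bCoef_aZ_1, cCoef_aZ_1, cCoef_aZ_2, cCoef_aZ_3, cCoef_aZ_4, T_one, eval_T_aZ_2,
    eval_T_aZ_3, eval_T_aZ_4]
  ring

theorem eval_T_aZ_6 (x : ℝ) : (T 1 aZ 6).eval x = 1 / 10 * x ^ 5 - 11 / 16 * x ^ 4 +
    241 / 144 * x ^ 3 - 2629 / 1440 * x ^ 2 + 7709 / 8640 * x - 17627 / 113400 := by
  rw [eval_T_eq 1 aZ x 4 5 rfl]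
  norm_num [Finset.sum_range_succ, Finset.sum_Icc_succ_top, fall, Finset.prod_range_succ,
    Nat.factorial, powCoeff_weight_1, powCoeff_weight_2, powCoeff_weight_3, powCoeff_weight_4,
    powCoeff_weight_5, bCoef_aZ_1, cCoef_aZ_1, cCoef_aZ_2, cCoef_aZ_3, cCoef_aZ_4, cCoef_aZ_5,
    T_one, eval_T_aZ_2, eval_T_aZ_3, eval_T_aZ_4, eval_T_aZ_5]
  ring

theorem eval_P_aZ_1 (x : ℝ) : (P 1 aZ 1).eval x = x := by
  rw [eval_P_eq 1 aZ x 1 (by norm_num)]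
  norm_num [Finset.sum_range_succ, fall, Finset.prod_range_succ, Nat.factorial,
    powCoeff_weight_1, T_one]

theorem eval_P_aZ_2 (x : ℝ) : (P 1 aZ 2).eval x = x ^ 2 + 1 / 2 * x + 1 / 6 := by
  rw [eval_P_eq 1 aZ x 2 (by norm_num)]
  norm_num [Finset.sum_range_succ, fall, Finset.prod_range_succ, Nat.factorial,
    powCoeff_weight_2, T_one, eval_T_aZ_2]
  ring

theorem eval_P_aZ_3 (x : ℝ) : (P 1 aZ 3).eval x = x ^ 3 + 5 / 4 * x ^ 2 + 3 / 4 * x + 7 / 48 := by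
  rw [eval_P_eq 1 aZ x 3 (by norm_num)]
  norm_num [Finset.sum_range_succ, fall, Finset.prod_range_succ, Nat.factorial,
    powCoeff_weight_3, T_one, eval_T_aZ_2, eval_T_aZ_3]
  ring

theorem eval_P_aZ_4 (x : ℝ) : (P 1 aZ 4).eval x = x ^ 4 + 13 / 6 * x ^ 3 + 17 / 8 * x ^ 2 +
    23 / 24 * x + 707 / 4320 := by
  rw [eval_P_eq 1 aZ x 4 (by norm_num)]
  norm_num [Finset.sum_range_succ, fall, Finset.prod_range_succ, Nat.factorial,
    powCoeff_weight_4, T_one, eval_T_aZ_2, eval_T_aZ_3, eval_T_aZ_4]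
  ring

theorem eval_P_aZ_5 (x : ℝ) : (P 1 aZ 5).eval x = x ^ 5 + 77 / 24 * x ^ 4 + 37 / 8 * x ^ 3 +
    83 / 24 * x ^ 2 + 1121 / 864 * x + 1637 / 8640 := by
  rw [eval_P_eq 1 aZ x 5 (by norm_num)]
  norm_num [Finset.sum_range_succ, fall, Finset.prod_range_succ, Nat.factorial,
    powCoeff_weight_5, T_one, eval_T_aZ_2, eval_T_aZ_3, eval_T_aZ_4, eval_T_aZ_5]
  ring

theorem eval_P_aZ_6 (x : ℝ) : (P 1 aZ 6).eval x = x ^ 6 + 87 / 20 * x ^ 5 + 205 / 24 * x ^ 4 +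
    443 / 48 * x ^ 3 + 1619 / 288 * x ^ 2 + 15427 / 8640 * x + 274133 / 1209600 := by
  rw [eval_P_eq 1 aZ x 6 (by norm_num)]
  norm_num [Finset.sum_range_succ, fall, Finset.prod_range_succ, Nat.factorial,
    powCoeff_weight_6, T_one, eval_T_aZ_2, eval_T_aZ_3, eval_T_aZ_4, eval_T_aZ_5, eval_T_aZ_6]
  ring

/-- For W the quotient x/W(x) is exp(W(x)), whose coefficients are these b_j. -/
theorem bCoef_aW_1 : bCoef 1 aW 1 = -1 / 2 := by
  rw [bCoef_eq 1 aW 1 2 rfl]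
  norm_num [lam_aW, Finset.sum_range_succ, fall, Finset.prod_range_succ, powCoeff_weight_2,
    aW, Nat.factorial]

theorem bCoef_aW_2 : bCoef 1 aW 2 = 2 / 3 := by
  rw [bCoef_eq 1 aW 2 3 rfl]
  norm_num [lam_aW, Finset.sum_range_succ, fall, Finset.prod_range_succ, powCoeff_weight_3,
    aW, Nat.factorial]

theorem bCoef_aW_3 : bCoef 1 aW 3 = -9 / 8 := by
  rw [bCoef_eq 1 aW 3 4 rfl]
  norm_num [lam_aW, Finset.sum_range_succ, fall, Finset.prod_range_succ, powCoeff_weight_4,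
    aW, Nat.factorial]

theorem bCoef_aW_4 : bCoef 1 aW 4 = 32 / 15 := by
  rw [bCoef_eq 1 aW 4 5 rfl]
  norm_num [lam_aW, Finset.sum_range_succ, fall, Finset.prod_range_succ, powCoeff_weight_5,
    aW, Nat.factorial]

theorem bCoef_aW_5 : bCoef 1 aW 5 = -625 / 144 := by
  rw [bCoef_eq 1 aW 5 6 rfl]
  norm_num [lam_aW, Finset.sum_range_succ, fall, Finset.prod_range_succ, powCoeff_weight_6,
    aW, Nat.factorial]

theorem bCoef_aW_6 : bCoef 1 aW 6 = 324 / 35 := by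
  rw [bCoef_eq 1 aW 6 7 rfl]
  norm_num [lam_aW, Finset.sum_range_succ, fall, Finset.prod_range_succ, powCoeff_weight_7,
    aW, Nat.factorial]

theorem aCoef_aW_0_2 : aCoef 1 aW 0 2 = -1 := by
  norm_num [aCoef_zero_eq, Finset.sum_range_succ, powCoeff_weight_2, oneB,
    bCoef_aW_1, Nat.factorial]

theorem aCoef_aW_0_3 : aCoef 1 aW 0 3 = 3 / 2 := by
  norm_num [aCoef_zero_eq, Finset.sum_range_succ, powCoeff_weight_3, oneB,
    bCoef_aW_1, bCoef_aW_2, Nat.factorial]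

theorem aCoef_aW_0_4 : aCoef 1 aW 0 4 = -8 / 3 := by
  norm_num [aCoef_zero_eq, Finset.sum_range_succ, powCoeff_weight_4, oneB,
    bCoef_aW_1, bCoef_aW_2, bCoef_aW_3, Nat.factorial]

theorem aCoef_aW_0_5 : aCoef 1 aW 0 5 = 125 / 24 := by
  norm_num [aCoef_zero_eq, Finset.sum_range_succ, powCoeff_weight_5, oneB,
    bCoef_aW_1, bCoef_aW_2, bCoef_aW_3, bCoef_aW_4, Nat.factorial]

theorem aCoef_aW_0_6 : aCoef 1 aW 0 6 = -54 / 5 := by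
  norm_num [aCoef_zero_eq, Finset.sum_range_succ, powCoeff_weight_6, oneB,
    bCoef_aW_1, bCoef_aW_2, bCoef_aW_3, bCoef_aW_4, bCoef_aW_5, Nat.factorial]

theorem aCoef_aW_1_3 : aCoef 1 aW 1 3 = 3 / 2 := by
  rw [aCoef_eq 1 aW 1 3 (by norm_num)]
  norm_num [Finset.sum_range_succ, fall, Finset.prod_range_succ, powCoeff_weight_2, oneB,
    bCoef_aW_1, Nat.factorial]

theorem aCoef_aW_1_4 : aCoef 1 aW 1 4 = -8 / 3 := by
  rw [aCoef_eq 1 aW 1 4 (by norm_num)]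
  norm_num [Finset.sum_range_succ, fall, Finset.prod_range_succ, powCoeff_weight_3, oneB,
    bCoef_aW_1, bCoef_aW_2, Nat.factorial]

theorem aCoef_aW_1_5 : aCoef 1 aW 1 5 = 125 / 24 := by
  rw [aCoef_eq 1 aW 1 5 (by norm_num)]
  norm_num [Finset.sum_range_succ, fall, Finset.prod_range_succ, powCoeff_weight_4, oneB,
    bCoef_aW_1, bCoef_aW_2, bCoef_aW_3, Nat.factorial]

theorem aCoef_aW_1_6 : aCoef 1 aW 1 6 = -54 / 5 := by
  rw [aCoef_eq 1 aW 1 6 (by norm_num)]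
  norm_num [Finset.sum_range_succ, fall, Finset.prod_range_succ, powCoeff_weight_5, oneB,
    bCoef_aW_1, bCoef_aW_2, bCoef_aW_3, bCoef_aW_4, Nat.factorial]

theorem aCoef_aW_2_4 : aCoef 1 aW 2 4 = 4 := by
  rw [aCoef_eq 1 aW 2 4 (by norm_num)]
  norm_num [Finset.sum_range_succ, fall, Finset.prod_range_succ, powCoeff_weight_2, oneB,
    bCoef_aW_1, Nat.factorial]

theorem aCoef_aW_2_5 : aCoef 1 aW 2 5 = -25 / 3 := by
  rw [aCoef_eq 1 aW 2 5 (by norm_num)]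
  norm_num [Finset.sum_range_succ, fall, Finset.prod_range_succ, powCoeff_weight_3, oneB,
    bCoef_aW_1, bCoef_aW_2, Nat.factorial]

theorem aCoef_aW_2_6 : aCoef 1 aW 2 6 = 18 := by
  rw [aCoef_eq 1 aW 2 6 (by norm_num)]
  norm_num [Finset.sum_range_succ, fall, Finset.prod_range_succ, powCoeff_weight_4, oneB,
    bCoef_aW_1, bCoef_aW_2, bCoef_aW_3, Nat.factorial]

theorem aCoef_aW_3_5 : aCoef 1 aW 3 5 = 15 / 2 := by
  rw [aCoef_eq 1 aW 3 5 (by norm_num)]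
  norm_num [Finset.sum_range_succ, fall, Finset.prod_range_succ, powCoeff_weight_2, oneB,
    bCoef_aW_1, Nat.factorial]

theorem aCoef_aW_3_6 : aCoef 1 aW 3 6 = -18 := by
  rw [aCoef_eq 1 aW 3 6 (by norm_num)]
  norm_num [Finset.sum_range_succ, fall, Finset.prod_range_succ, powCoeff_weight_3, oneB,
    bCoef_aW_1, bCoef_aW_2, Nat.factorial]

theorem aCoef_aW_4_6 : aCoef 1 aW 4 6 = 12 := by
  rw [aCoef_eq 1 aW 4 6 (by norm_num)]
  norm_num [Finset.sum_range_succ, fall, Finset.prod_range_succ, powCoeff_weight_2, oneB,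
    bCoef_aW_1, Nat.factorial]

theorem cCoef_aW_0 : cCoef 1 aW 0 = 1 / 2 := by
  rw [cCoef, bCoef_aW_1]
  norm_num

theorem cCoef_aW_1 : cCoef 1 aW 1 = 1 / 6 := by
  rw [cCoef_eq 1 aW 0 1 rfl]
  norm_num [Finset.sum_range_succ, bCoef_aW_2, aCoef_aW_0_2, cCoef_aW_0]

theorem cCoef_aW_2 : cCoef 1 aW 2 = -1 / 16 := by
  rw [cCoef_eq 1 aW 1 2 rfl]
  norm_num [Finset.sum_range_succ, bCoef_aW_3, aCoef_aW_0_3, aCoef_aW_1_3, cCoef_aW_0, cCoef_aW_1]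

theorem cCoef_aW_3 : cCoef 1 aW 3 = 19 / 540 := by
  rw [cCoef_eq 1 aW 2 3 rfl]
  norm_num [Finset.sum_range_succ, bCoef_aW_4, aCoef_aW_0_4, aCoef_aW_1_4, aCoef_aW_2_4,
    cCoef_aW_0, cCoef_aW_1, cCoef_aW_2]

theorem cCoef_aW_4 : cCoef 1 aW 4 = -1 / 48 := by
  rw [cCoef_eq 1 aW 3 4 rfl]
  norm_num [Finset.sum_range_succ, bCoef_aW_5, aCoef_aW_0_5, aCoef_aW_1_5, aCoef_aW_2_5,
    aCoef_aW_3_5, cCoef_aW_0, cCoef_aW_1, cCoef_aW_2, cCoef_aW_3]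

theorem cCoef_aW_5 : cCoef 1 aW 5 = 41 / 4200 := by
  rw [cCoef_eq 1 aW 4 5 rfl]
  norm_num [Finset.sum_range_succ, bCoef_aW_6, aCoef_aW_0_6, aCoef_aW_1_6, aCoef_aW_2_6,
    aCoef_aW_3_6, aCoef_aW_4_6, cCoef_aW_0, cCoef_aW_1, cCoef_aW_2, cCoef_aW_3, cCoef_aW_4]

theorem eval_T_aW_2 (x : ℝ) : (T 1 aW 2).eval x = -(1 / 2) * x - 1 / 6 := by
  rw [eval_T_eq 1 aW x 0 1 rfl]
  norm_num [Finset.sum_range_succ, Finset.sum_Icc_succ_top, fall, Finset.prod_range_succ,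
    Nat.factorial, powCoeff_weight_1, bCoef_aW_1, cCoef_aW_1, T_one]

theorem eval_T_aW_3 (x : ℝ) : (T 1 aW 3).eval x = 1 / 4 * x ^ 2 + 5 / 12 * x + 7 / 48 := by
  rw [eval_T_eq 1 aW x 1 2 rfl]
  norm_num [Finset.sum_range_succ, Finset.sum_Icc_succ_top, fall, Finset.prod_range_succ,
    Nat.factorial, powCoeff_weight_1, powCoeff_weight_2, bCoef_aW_1, cCoef_aW_1, cCoef_aW_2,
    T_one, eval_T_aW_2]
  ring

theorem eval_T_aW_4 (x : ℝ) : (T 1 aW 4).eval x = -(1 / 6) * x ^ 3 - 13 / 24 * x ^ 2 -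
    1 / 2 * x - 587 / 4320 := by
  rw [eval_T_eq 1 aW x 2 3 rfl]
  norm_num [Finset.sum_range_succ, Finset.sum_Icc_succ_top, fall, Finset.prod_range_succ,
    Nat.factorial, powCoeff_weight_1, powCoeff_weight_2, powCoeff_weight_3, bCoef_aW_1,
    cCoef_aW_1, cCoef_aW_2, cCoef_aW_3, T_one, eval_T_aW_2, eval_T_aW_3]
  ring

theorem eval_T_aW_5 (x : ℝ) : (T 1 aW 5).eval x = 1 / 8 * x ^ 4 + 5 / 8 * x ^ 3 +
    49 / 48 * x ^ 2 + 947 / 1440 * x + 1217 / 8640 := by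
  rw [eval_T_eq 1 aW x 3 4 rfl]
  norm_num [Finset.sum_range_succ, Finset.sum_Icc_succ_top, fall, Finset.prod_range_succ,
    Nat.factorial, powCoeff_weight_1, powCoeff_weight_2, powCoeff_weight_3, powCoeff_weight_4,
    bCoef_aW_1, cCoef_aW_1, cCoef_aW_2, cCoef_aW_3, cCoef_aW_4, T_one, eval_T_aW_2,
    eval_T_aW_3, eval_T_aW_4]
  ring

theorem eval_T_aW_6 (x : ℝ) : (T 1 aW 6).eval x = -(1 / 10) * x ^ 5 - 11 / 16 * x ^ 4 -
    241 / 144 * x ^ 3 - 2629 / 1440 * x ^ 2 - 7709 / 8640 * x - 17627 / 113400 := by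
  rw [eval_T_eq 1 aW x 4 5 rfl]
  norm_num [Finset.sum_range_succ, Finset.sum_Icc_succ_top, fall, Finset.prod_range_succ,
    Nat.factorial, powCoeff_weight_1, powCoeff_weight_2, powCoeff_weight_3, powCoeff_weight_4,
    powCoeff_weight_5, bCoef_aW_1, cCoef_aW_1, cCoef_aW_2, cCoef_aW_3, cCoef_aW_4, cCoef_aW_5,
    T_one, eval_T_aW_2, eval_T_aW_3, eval_T_aW_4, eval_T_aW_5]
  ring

theorem eval_P_aW_1 (x : ℝ) : (P 1 aW 1).eval x = x := by
  rw [eval_P_eq 1 aW x 1 (by norm_num)]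
  norm_num [Finset.sum_range_succ, fall, Finset.prod_range_succ, Nat.factorial,
    powCoeff_weight_1, T_one]

theorem eval_P_aW_2 (x : ℝ) : (P 1 aW 2).eval x = x ^ 2 - 1 / 2 * x + 1 / 6 := by
  rw [eval_P_eq 1 aW x 2 (by norm_num)]
  norm_num [Finset.sum_range_succ, fall, Finset.prod_range_succ, Nat.factorial,
    powCoeff_weight_2, T_one, eval_T_aW_2]
  ring

theorem eval_P_aW_3 (x : ℝ) : (P 1 aW 3).eval x = x ^ 3 - 5 / 4 * x ^ 2 + 3 / 4 * x - 7 / 48 := by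
  rw [eval_P_eq 1 aW x 3 (by norm_num)]
  norm_num [Finset.sum_range_succ, fall, Finset.prod_range_succ, Nat.factorial,
    powCoeff_weight_3, T_one, eval_T_aW_2, eval_T_aW_3]
  ring

theorem eval_P_aW_4 (x : ℝ) : (P 1 aW 4).eval x = x ^ 4 - 13 / 6 * x ^ 3 + 17 / 8 * x ^ 2 -
    23 / 24 * x + 707 / 4320 := by
  rw [eval_P_eq 1 aW x 4 (by norm_num)]
  norm_num [Finset.sum_range_succ, fall, Finset.prod_range_succ, Nat.factorial,
    powCoeff_weight_4, T_one, eval_T_aW_2, eval_T_aW_3, eval_T_aW_4]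
  ring

theorem eval_P_aW_5 (x : ℝ) : (P 1 aW 5).eval x = x ^ 5 - 77 / 24 * x ^ 4 + 37 / 8 * x ^ 3 -
    83 / 24 * x ^ 2 + 1121 / 864 * x - 1637 / 8640 := by
  rw [eval_P_eq 1 aW x 5 (by norm_num)]
  norm_num [Finset.sum_range_succ, fall, Finset.prod_range_succ, Nat.factorial,
    powCoeff_weight_5, T_one, eval_T_aW_2, eval_T_aW_3, eval_T_aW_4, eval_T_aW_5]
  ring

theorem eval_P_aW_6 (x : ℝ) : (P 1 aW 6).eval x = x ^ 6 - 87 / 20 * x ^ 5 + 205 / 24 * x ^ 4 -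
    443 / 48 * x ^ 3 + 1619 / 288 * x ^ 2 - 15427 / 8640 * x + 274133 / 1209600 := by
  rw [eval_P_eq 1 aW x 6 (by norm_num)]
  norm_num [Finset.sum_range_succ, fall, Finset.prod_range_succ, Nat.factorial,
    powCoeff_weight_6, T_one, eval_T_aW_2, eval_T_aW_3, eval_T_aW_4, eval_T_aW_5, eval_T_aW_6]
  ring

end Values

/-! ### Sign patterns and the symmetry between the two sets of data. -/

section Signs

/-- The polynomial with the given list of coefficients, the constant one first. -/
noncomputable def ofCoeffs : List ℝ → ℝ[X]
  | [] => 0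
  | c :: l => C c + X * ofCoeffs l

theorem coeff_ofCoeffs (l : List ℝ) (k : ℕ) : (ofCoeffs l).coeff k = l.getD k 0 := by
  induction l generalizing k with
  | nil => simp [ofCoeffs]
  | cons c l ih => cases k <;> simp [ofCoeffs, coeff_C, ih]

theorem natDegree_ofCoeffs_lt {l : List ℝ} (hl : l ≠ []) :
    (ofCoeffs l).natDegree < l.length := by
  refine Nat.lt_of_le_pred (List.length_pos_iff.2 hl) (natDegree_le_iff_coeff_eq_zero.2 ?_)
  intro k hk
  rw [coeff_ofCoeffs, List.getD_eq_default]
  exact Nat.le_of_pred_lt hk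

/-- The bound degree < length already places every relevant index inside the list, so the exact
degree is not needed. -/
theorem posCoeffs_ofCoeffs {l : List ℝ} (hl : l ≠ []) (h : ∀ c ∈ l, 0 < c) :
    PosCoeffs (ofCoeffs l) := by
  intro k hk
  have hk' := hk.trans_lt (natDegree_ofCoeffs_lt hl)
  rw [coeff_ofCoeffs, List.getD_eq_getElem _ _ hk']
  exact h _ (List.getElem_mem hk')

theorem sameSignCoeffs_of_posCoeffs {p : ℝ[X]} (h : PosCoeffs p) : SameSignCoeffs p :=
  fun k hk l hl => mul_pos (h k hk) (h l hl)

theorem sameSignCoeffs_of_posCoeffs_neg {p : ℝ[X]} (h : PosCoeffs (-p)) : SameSignCoeffs p := by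
  intro k hk l hl
  rw [← natDegree_neg] at hk hl
  simpa using mul_pos (h k hk) (h l hl)

/-- Substituting -X multiplies the k-th coefficient by (-1)^k, so positivity after substitution
means alternation before it. -/
theorem altCoeffs_of_posCoeffs_comp_neg {p : ℝ[X]} (h : PosCoeffs (p.comp (-X))) :
    AltCoeffs p := by
  intro k hk
  have hdeg : (p.comp (-X)).natDegree = p.natDegree := by simp [natDegree_comp]
  have hcoeff : ∀ k, (p.comp (-X)).coeff k = (-1) ^ k * p.coeff k := fun k => by
    rw [show (-X : ℝ[X]) = C (-1) * X by simp, comp_C_mul_X_coeff, mul_comm]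
  have h0 := h k (by omega)
  have h1 := h (k + 1) (by omega)
  rw [hcoeff] at h0 h1
  have h2 := mul_pos h0 h1
  have h3 : (-1 : ℝ) ^ k * (-1) ^ (k + 1) = -1 := by
    rw [← pow_add]
    exact Odd.neg_one_pow ⟨k, by ring⟩
  have h4 : (-1 : ℝ) ^ k * p.coeff k * ((-1) ^ (k + 1) * p.coeff (k + 1)) =
      -(p.coeff k * p.coeff (k + 1)) := by
    linear_combination (p.coeff k * p.coeff (k + 1)) * h3
  linarith

theorem altCoeffs_neg {p : ℝ[X]} (h : AltCoeffs (-p)) : AltCoeffs p := by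
  intro k hk
  rw [← natDegree_neg] at hk
  simpa using h k hk

theorem neg_T_aW_2 : -T 1 aW 2 = ofCoeffs [1 / 6, 1 / 2] := by
  refine Polynomial.funext fun x => ?_
  simp only [ofCoeffs, eval_neg, eval_T_aW_2, eval_add, eval_mul, eval_C, eval_X, eval_zero]
  ring

theorem P_aZ_2 : P 1 aZ 2 = ofCoeffs [1 / 6, 1 / 2, 1] := by
  refine Polynomial.funext fun x => ?_
  simp only [ofCoeffs, eval_P_aZ_2, eval_add, eval_mul, eval_C, eval_X, eval_zero]
  ring

theorem T_aW_3 : T 1 aW 3 = ofCoeffs [7 / 48, 5 / 12, 1 / 4] := by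
  refine Polynomial.funext fun x => ?_
  simp only [ofCoeffs, eval_T_aW_3, eval_add, eval_mul, eval_C, eval_X, eval_zero]
  ring

theorem P_aZ_3 : P 1 aZ 3 = ofCoeffs [7 / 48, 3 / 4, 5 / 4, 1] := by
  refine Polynomial.funext fun x => ?_
  simp only [ofCoeffs, eval_P_aZ_3, eval_add, eval_mul, eval_C, eval_X, eval_zero]
  ring

theorem neg_T_aW_4 : -T 1 aW 4 = ofCoeffs [587 / 4320, 1 / 2, 13 / 24, 1 / 6] := by
  refine Polynomial.funext fun x => ?_
  simp only [ofCoeffs, eval_neg, eval_T_aW_4, eval_add, eval_mul, eval_C, eval_X, eval_zero]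
  ring

theorem P_aZ_4 : P 1 aZ 4 = ofCoeffs [707 / 4320, 23 / 24, 17 / 8, 13 / 6, 1] := by
  refine Polynomial.funext fun x => ?_
  simp only [ofCoeffs, eval_P_aZ_4, eval_add, eval_mul, eval_C, eval_X, eval_zero]
  ring

theorem T_aW_5 : T 1 aW 5 = ofCoeffs [1217 / 8640, 947 / 1440, 49 / 48, 5 / 8, 1 / 8] := by
  refine Polynomial.funext fun x => ?_
  simp only [ofCoeffs, eval_T_aW_5, eval_add, eval_mul, eval_C, eval_X, eval_zero]
  ring

theorem P_aZ_5 : P 1 aZ 5 = ofCoeffs [1637 / 8640, 1121 / 864, 83 / 24, 37 / 8, 77 / 24, 1] := by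
  refine Polynomial.funext fun x => ?_
  simp only [ofCoeffs, eval_P_aZ_5, eval_add, eval_mul, eval_C, eval_X, eval_zero]
  ring

theorem neg_T_aW_6 : -T 1 aW 6 = ofCoeffs [17627 / 113400, 7709 / 8640, 2629 / 1440, 241 / 144,
    11 / 16, 1 / 10] := by
  refine Polynomial.funext fun x => ?_
  simp only [ofCoeffs, eval_neg, eval_T_aW_6, eval_add, eval_mul, eval_C, eval_X, eval_zero]
  ring

theorem P_aZ_6 : P 1 aZ 6 = ofCoeffs [274133 / 1209600, 15427 / 8640, 1619 / 288, 443 / 48,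
    205 / 24, 87 / 20, 1] := by
  refine Polynomial.funext fun x => ?_
  simp only [ofCoeffs, eval_P_aZ_6, eval_add, eval_mul, eval_C, eval_X, eval_zero]
  ring

theorem T_aZ_eq : ∀ m ∈ Finset.Icc 1 6, T 1 aZ m = (-1) ^ m * (T 1 aW m).comp (-X) := by
  intro m hm
  refine Polynomial.funext fun x => ?_
  obtain ⟨h1, h6⟩ := Finset.mem_Icc.1 hm
  interval_cases m <;>
    simp only [eval_mul, eval_pow, eval_neg, eval_one, eval_comp, eval_X, T_one, eval_T_aZ_2,
      eval_T_aZ_3, eval_T_aZ_4, eval_T_aZ_5, eval_T_aZ_6, eval_T_aW_2, eval_T_aW_3, eval_T_aW_4,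
      eval_T_aW_5, eval_T_aW_6] <;> ring

theorem P_aZ_eq : ∀ m ∈ Finset.Icc 1 6, P 1 aZ m = (-1) ^ m * (P 1 aW m).comp (-X) := by
  intro m hm
  refine Polynomial.funext fun x => ?_
  obtain ⟨h1, h6⟩ := Finset.mem_Icc.1 hm
  interval_cases m <;>
    simp only [eval_mul, eval_pow, eval_neg, eval_one, eval_comp, eval_X, eval_P_aZ_1,
      eval_P_aZ_2, eval_P_aZ_3, eval_P_aZ_4, eval_P_aZ_5, eval_P_aZ_6, eval_P_aW_1, eval_P_aW_2,
      eval_P_aW_3, eval_P_aW_4, eval_P_aW_5, eval_P_aW_6] <;> ring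

/-- Both b_1 and the sign of K are opposite for the two functions, so the arguments of P_m are
negatives of each other and the symmetry of P_m applies. -/
theorem block_aZ_eq (m : ℕ) (hm : m ∈ Finset.Icc 1 6) :
    block 1 aZ (-1) m = (-1) ^ m * block 1 aW 1 m := by
  rw [block, block, P_aZ_eq m hm, map_mul, map_pow, map_neg, map_one, aeval_comp, map_neg, aeval_X,
    bCoef_aZ_1, bCoef_aW_1]
  congr 3
  norm_num
  ring

theorem posCoeffs_P_aZ : ∀ m ∈ Finset.Icc 2 6, PosCoeffs (P 1 aZ m) := by
  intro m hm
  obtain ⟨h2, h6⟩ := Finset.mem_Icc.1 hm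
  interval_cases m
  · rw [P_aZ_2]; exact posCoeffs_ofCoeffs (by simp) (by norm_num)
  · rw [P_aZ_3]; exact posCoeffs_ofCoeffs (by simp) (by norm_num)
  · rw [P_aZ_4]; exact posCoeffs_ofCoeffs (by simp) (by norm_num)
  · rw [P_aZ_5]; exact posCoeffs_ofCoeffs (by simp) (by norm_num)
  · rw [P_aZ_6]; exact posCoeffs_ofCoeffs (by simp) (by norm_num)

theorem posCoeffs_T_aW : ∀ m ∈ Finset.Icc 2 6, PosCoeffs (T 1 aW m) ∨ PosCoeffs (-T 1 aW m) := by
  intro m hm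
  obtain ⟨h2, h6⟩ := Finset.mem_Icc.1 hm
  interval_cases m
  · rw [neg_T_aW_2]; exact .inr (posCoeffs_ofCoeffs (by simp) (by norm_num))
  · rw [T_aW_3]; exact .inl (posCoeffs_ofCoeffs (by simp) (by norm_num))
  · rw [neg_T_aW_4]; exact .inr (posCoeffs_ofCoeffs (by simp) (by norm_num))
  · rw [T_aW_5]; exact .inl (posCoeffs_ofCoeffs (by simp) (by norm_num))
  · rw [neg_T_aW_6]; exact .inr (posCoeffs_ofCoeffs (by simp) (by norm_num))

theorem sameSignCoeffs_T_aW : ∀ m ∈ Finset.Icc 2 6, SameSignCoeffs (T 1 aW m) := fun m hm =>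
  (posCoeffs_T_aW m hm).elim sameSignCoeffs_of_posCoeffs sameSignCoeffs_of_posCoeffs_neg

theorem altCoeffs_of_eq_neg_one_pow_mul {p q : ℝ[X]} {m : ℕ} (h : p = (-1) ^ m * q.comp (-X))
    (hq : PosCoeffs q ∨ PosCoeffs (-q)) : AltCoeffs p := by
  have key : ∀ r : ℝ[X], PosCoeffs r → AltCoeffs (r.comp (-X)) := fun r hr =>
    altCoeffs_of_posCoeffs_comp_neg (by simpa [comp_assoc] using hr)
  have hq' : AltCoeffs (q.comp (-X)) := by
    rcases hq with hq | hq
    · exact key q hq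
    · exact altCoeffs_neg (by simpa using key _ hq)
  rcases neg_one_pow_eq_or ℝ[X] m with hm | hm
  · rwa [h, hm, one_mul]
  · refine altCoeffs_neg ?_
    rwa [h, hm, neg_mul, one_mul, neg_neg]

theorem altCoeffs_T_aZ (m : ℕ) (hm : m ∈ Finset.Icc 2 6) : AltCoeffs (T 1 aZ m) :=
  altCoeffs_of_eq_neg_one_pow_mul
    (T_aZ_eq m (Finset.Icc_subset_Icc_left (by norm_num) hm)) (posCoeffs_T_aW m hm)

theorem altCoeffs_P_aW (m : ℕ) (hm : m ∈ Finset.Icc 2 6) : AltCoeffs (P 1 aW m) := by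
  refine altCoeffs_of_eq_neg_one_pow_mul (m := m) ?_ (.inl (posCoeffs_P_aZ m hm))
  rw [P_aZ_eq m (Finset.Icc_subset_Icc_left (by norm_num) hm)]
  simp [comp_assoc, ← mul_assoc, ← mul_pow]

end Signs

/-! ### Taylor series of Z and W at the origin. -/

section TaylorStart

/-- Every exponential term below, in the Taylor series and in Abel's equation, is truncated with
this remainder; m + n fixes a common order for terms with different monomial factors. -/
theorem pow_mul_exp_mul_sub_isBigO (k : ℝ) (m n N : ℕ) (hN : m + n = N) :
    (fun x : ℝ => x ^ m * (Real.exp (k * x) - ∑ i ∈ Finset.range n, (k * x) ^ i / (i.factorial : ℝ)))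
      =O[nhds 0] fun x : ℝ => x ^ N := by
  have hk : Tendsto (fun x : ℝ => k * x) (nhds 0) (nhds 0) := by
    simpa using (continuous_const_mul k).tendsto (0 : ℝ)
  have h1 := (Real.exp_sub_sum_range_isBigO_pow n).comp_tendsto hk
  have h2 : (fun x : ℝ => (k * x) ^ n) =O[nhds 0] fun x : ℝ => x ^ n :=
    (isBigO_const_mul_self k (fun x : ℝ => x) (nhds 0)).pow n
  have h3 := (isBigO_refl (fun x : ℝ => x ^ m) (nhds 0)).mul (h1.trans h2)
  subst hN
  simpa only [Function.comp_def, pow_add] using h3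

theorem hasTaylorStart_Z : HasTaylorStart Z 1 aZ := by
  refine ⟨?_, ?_⟩
  · unfold Z
    fun_prop
  · refine (pow_mul_exp_mul_sub_isBigO (-1) 1 8 9 rfl).congr_left fun x => ?_
    rw [Z, neg_one_mul]
    norm_num [Finset.sum_range_succ, Finset.sum_Icc_succ_top, aZ, Nat.factorial]
    ring

theorem strictMonoOn_mul_exp : StrictMonoOn (fun w : ℝ => w * Real.exp w) (Set.Ici (-1)) := by
  refine strictMonoOn_of_deriv_pos (convex_Ici _) (by fun_prop) fun w hw => ?_
  rw [interior_Ici, Set.mem_Ioi] at hw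
  have : deriv (fun w : ℝ => w * Real.exp w) w = (1 + w) * Real.exp w := by
    rw [deriv_fun_mul (by fun_prop) (by fun_prop), deriv_id'', Real.deriv_exp]
    ring
  rw [this]
  exact mul_pos (by linarith) (Real.exp_pos w)

theorem lambertW_mul_exp {w : ℝ} (hw : -1 ≤ w) : lambertW (w * Real.exp w) = w :=
  strictMonoOn_mul_exp.injOn.leftInvOn_invFunOn (Set.mem_Ici.2 hw)

theorem lambertW_zero : lambertW 0 = 0 := by
  simpa using lambertW_mul_exp (w := 0) (by norm_num)

/-- Since 0 ≤ x ≤ x exp(x), the intermediate value theorem on [0, x] gives a preimage, and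
injectivity on [-1, ∞) identifies it with W(x). -/
theorem lambertW_pos_and_mul_exp {x : ℝ} (hx : 0 < x) :
    0 < lambertW x ∧ lambertW x * Real.exp (lambertW x) = x := by
  have hmem : x ∈ Set.Icc ((fun w : ℝ => w * Real.exp w) 0) ((fun w : ℝ => w * Real.exp w) x) :=
    ⟨by simpa using hx.le, le_mul_of_one_le_right hx.le (Real.one_le_exp hx.le)⟩
  obtain ⟨w, hw, rfl⟩ := intermediate_value_Icc hx.le
    (f := fun w : ℝ => w * Real.exp w) (by fun_prop) hmem
  simp only [lambertW_mul_exp (show -1 ≤ w by linarith [hw.1])]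
  exact ⟨pos_of_mul_pos_left hx (Real.exp_pos w).le, trivial⟩

/-- The derivative of w exp(w) at 0 is 1, so an analytic local inverse exists. Near 0 its values
exceed -1, where w exp(w) is injective, so it coincides with `lambertW`. -/
theorem analyticAt_lambertW_zero : AnalyticAt ℝ lambertW 0 ∧
    ∀ᶠ x in nhds 0, lambertW x * Real.exp (lambertW x) = x := by
  have han : AnalyticAt ℝ (fun w : ℝ => w * Real.exp w) 0 := by fun_prop
  have hder : HasDerivAt (fun w : ℝ => w * Real.exp w) 1 0 := by
    simpa using (hasDerivAt_id' (0 : ℝ)).fun_mul (Real.hasDerivAt_exp 0)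
  have hfder : HasFDerivAt (fun w : ℝ => w * Real.exp w)
      ((ContinuousLinearEquiv.refl ℝ ℝ : ℝ ≃L[ℝ] ℝ) : ℝ →L[ℝ] ℝ) 0 := by
    refine hder.hasFDerivAt.congr_fderiv ?_
    ext
    simp
  have hcd : ContDiffAt ℝ 1 (fun w : ℝ => w * Real.exp w) 0 := han.contDiffAt
  set e := hcd.toOpenPartialHomeomorph (fun w : ℝ => w * Real.exp w) hfder one_ne_zero with he
  have hcoe : (e : ℝ → ℝ) = fun w : ℝ => w * Real.exp w :=
    hcd.toOpenPartialHomeomorph_coe hfder one_ne_zero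
  have h0s : (0 : ℝ) ∈ e.source := hcd.mem_toOpenPartialHomeomorph_source hfder one_ne_zero
  have h00 : e 0 = 0 := by simp [hcoe]
  have h0t : (0 : ℝ) ∈ e.target := by
    have := e.map_source h0s
    rwa [h00] at this
  have hs0 : e.symm 0 = 0 := by
    have := e.left_inv h0s
    rwa [h00] at this
  have hsymm : AnalyticAt ℝ e.symm 0 := by
    refine e.analyticAt_symm (i := ContinuousLinearEquiv.refl ℝ ℝ) h0t ?_ ?_
    · rw [hs0, hcoe]
      exact han
    · rw [hs0, hcoe]
      exact hfder.fderiv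
  have hev : ∀ᶠ x in nhds 0, e.symm x * Real.exp (e.symm x) = x ∧ -1 ≤ e.symm x := by
    have hc := hsymm.continuousAt
    have h1 : ∀ᶠ x in nhds 0, -1 < e.symm x :=
      hc.eventually (lt_mem_nhds (by rw [hs0]; norm_num))
    filter_upwards [h1, e.open_target.mem_nhds h0t] with x hx1 hx2
    have := e.right_inv hx2
    rw [hcoe] at this
    exact ⟨this, hx1.le⟩
  have heq : ∀ᶠ x in nhds 0, e.symm x = lambertW x := by
    filter_upwards [hev] with x hx
    conv_rhs => rw [← hx.1]
    exact (lambertW_mul_exp hx.2).symm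
  refine ⟨hsymm.congr heq, ?_⟩
  filter_upwards [hev, heq] with x hx hx'
  rw [← hx']
  exact hx.1

theorem hasTaylorStart_lambertW : HasTaylorStart lambertW 1 aW := by
  refine ⟨analyticAt_lambertW_zero.1, ?_⟩
  -- Substituting x = w exp(w) turns the claim about W into one about exponentials. The term x is
  -- the case m = 0, as a_0 = 1, and the Taylor polynomials cancel against w through degree 8.
  have hpoly : (fun w : ℝ => w - (w * Real.exp w +
      ∑ m ∈ Finset.Icc 1 7, aW m * (w * Real.exp w) ^ (m + 1))) =O[nhds 0]
      fun w : ℝ => w ^ 9 := by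
    have h : (fun w : ℝ => ∑ m ∈ Finset.range 8, -aW m * (w ^ (m + 1) *
        (Real.exp (((m + 1 : ℕ) : ℝ) * w) -
          ∑ i ∈ Finset.range (8 - m), (((m + 1 : ℕ) : ℝ) * w) ^ i / (i.factorial : ℝ)))) =O[nhds 0]
        fun w : ℝ => w ^ 9 := by
      refine IsBigO.fun_sum fun m hm => (pow_mul_exp_mul_sub_isBigO _ _ _ _ ?_).const_mul_left _
      have := Finset.mem_range.1 hm
      omega
    refine h.congr_left fun w => ?_
    simp only [Real.exp_nat_mul]
    norm_num [Finset.sum_range_succ, Finset.sum_Icc_succ_top, aW, Nat.factorial]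
    ring
  have hlin : lambertW =O[nhds 0] fun x : ℝ => x := by
    simpa [lambertW_zero] using analyticAt_lambertW_zero.1.differentiableAt.isBigO_sub
  have hlim : Tendsto lambertW (nhds 0) (nhds 0) := by
    simpa [lambertW_zero] using analyticAt_lambertW_zero.1.continuousAt.tendsto
  refine ((hpoly.comp_tendsto hlim).trans (hlin.pow 9)).congr' ?_ .rfl
  filter_upwards [analyticAt_lambertW_zero.2] with x hx
  simp only [Function.comp_def, hx, mul_one]

theorem kindred_lambertW_Z : Kindred lambertW Z := by
  refine ⟨1, aW, aZ, le_rfl, by norm_num [aW], by norm_num [aZ], hasTaylorStart_lambertW,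
    hasTaylorStart_Z, by rw [lam_aZ, lam_aW], ?_, T_aZ_eq, P_aZ_eq, block_aZ_eq⟩
  intro i hi
  obtain ⟨h1, h5⟩ := Finset.mem_Icc.1 hi
  interval_cases i <;>
    norm_num [cCoef_aZ_1, cCoef_aZ_2, cCoef_aZ_3, cCoef_aZ_4, cCoef_aZ_5, cCoef_aW_1, cCoef_aW_2,
      cCoef_aW_3, cCoef_aW_4, cCoef_aW_5]

end TaylorStart

/-! ### A truncated Abel function and its expansion property. -/

section AbelFunction

/-- A truncated asymptotic solution of Abel's equation `ψ (Z s) = ψ s + 1` at the origin. -/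
noncomputable def abelFun (s : ℝ) : ℝ :=
  1 / s + Real.log s / 2 + 1 / 6 * s + 1 / 16 * s ^ 2 + 19 / 540 * s ^ 3

theorem abelFun_Z_sub_isBigO :
    (fun s : ℝ => abelFun (Z s) - abelFun s - 1) =O[nhdsWithin 0 {0}ᶜ] fun s : ℝ => s ^ 5 := by
  -- After multiplication by s the expression is a combination of exponentials and powers of s. The
  -- choice of coefficients makes all terms through s^5 cancel, leaving O(s^6).
  have h0 := pow_mul_exp_mul_sub_isBigO 1 0 6 6 rfl
  have h1 := (pow_mul_exp_mul_sub_isBigO (-1) 2 4 6 rfl).const_mul_left (1 / 6)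
  have h2 := (pow_mul_exp_mul_sub_isBigO (-2) 3 3 6 rfl).const_mul_left (1 / 16)
  have h3 := (pow_mul_exp_mul_sub_isBigO (-3) 4 2 6 rfl).const_mul_left (19 / 540)
  have h := (((h0.add h1).add h2).add h3).mono (nhdsWithin_le_nhds (s := {(0 : ℝ)}ᶜ))
  refine (h.mul (isBigO_refl (fun s : ℝ => s⁻¹) _)).congr' ?_ ?_
  · filter_upwards [self_mem_nhdsWithin] with s hs
    have hs0 : s ≠ 0 := hs
    have hlog : Real.log (s * Real.exp (-s)) = Real.log s - s := by
      rw [Real.log_mul hs0 (Real.exp_ne_zero _), Real.log_exp]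
      ring
    have e2 : Real.exp (-2 * s) = Real.exp (-s) ^ 2 := by rw [← Real.exp_nat_mul]; simp
    have e3 : Real.exp (-3 * s) = Real.exp (-s) ^ 3 := by rw [← Real.exp_nat_mul]; simp
    have e1 : Real.exp s = (Real.exp (-s))⁻¹ := by rw [Real.exp_neg, inv_inv]
    simp only [abelFun, Z, hlog, e2, e3, one_mul, neg_one_mul, e1]
    have hE := Real.exp_ne_zero (-s)
    norm_num [Finset.sum_range_succ, Nat.factorial]
    field_simp
    ring
  · filter_upwards [self_mem_nhdsWithin] with s hs
    have hs0 : s ≠ 0 := hs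
    field_simp

/-- Apply log x ≤ x - 1 to s/t and to t/s; equal signs keep both quotients positive. -/
theorem abs_log_div_mul_le {s t : ℝ} (hst : 0 < s * t) :
    |Real.log (s / t)| * |s * t| ≤ |s - t| * max |s| |t| := by
  have hs : s ≠ 0 := left_ne_zero_of_mul hst.ne'
  have ht : t ≠ 0 := right_ne_zero_of_mul hst.ne'
  have key : ∀ a b : ℝ, 0 < a * b → Real.log (a / b) * |a * b| ≤ |a - b| * |a| := by
    intro a b hab
    have hb : b ≠ 0 := right_ne_zero_of_mul hab.ne'
    have hq : 0 < a / b := by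
      rw [← mul_div_mul_right a b hb]
      exact div_pos hab (mul_self_pos.2 hb)
    have h1 : Real.log (a / b) ≤ (a - b) / b :=
      (Real.log_le_sub_one_of_pos hq).trans_eq (by field_simp)
    calc Real.log (a / b) * |a * b| ≤ (a - b) / b * |a * b| := by gcongr
      _ ≤ |(a - b) / b| * |a * b| := by gcongr; exact le_abs_self _
      _ = |a - b| * |a| := by
        rw [abs_mul, abs_div]
        field_simp
  rcases abs_cases (Real.log (s / t)) with ⟨h, _⟩ | ⟨h, _⟩
  · rw [h]
    exact (key s t hst).trans (by gcongr; exact le_max_left _ _)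
  · rw [h, ← Real.log_inv, inv_div, mul_comm s t, abs_sub_comm]
    exact (key t s (by linarith)).trans (by gcongr; exact le_max_right _ _)

/-- Multiplied by st, the difference of the terms 1/s is exactly t - s, while the logarithm and the
polynomial part contribute at most (1/4 + 1/8)|s - t|. Absorbing these leaves the factor 5/8, hence
the constant 2. -/
theorem abs_sub_le_abelFun {s t : ℝ} (hst : 0 < s * t) (hs : |s| ≤ 1 / 2) (ht : |t| ≤ 1 / 2) :
    |s - t| ≤ 2 * (|s| * |t| * |abelFun s - abelFun t|) := by
  have hs0 : s ≠ 0 := left_ne_zero_of_mul hst.ne'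
  have ht0 : t ≠ 0 := right_ne_zero_of_mul hst.ne'
  have hlog := (abs_log_div_mul_le hst).trans
    (mul_le_mul_of_nonneg_left (max_le hs ht) (abs_nonneg _))
  -- This is the divided difference of the polynomial part of `abelFun`.
  set g : ℝ := 1 / 6 + 1 / 16 * (s + t) + 19 / 540 * (s ^ 2 + s * t + t ^ 2) with hg
  have hid : t - s = s * t * (abelFun s - abelFun t) - s * t * Real.log (s / t) / 2
      - s * t * (s - t) * g := by
    rw [Real.log_div hs0 ht0, abelFun, abelFun, hg]
    field_simp
    ring
  have hs' := abs_le.1 hs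
  have ht' := abs_le.1 ht
  have hstle : |s * t| ≤ 1 / 4 := by
    rw [abs_mul]
    nlinarith [abs_nonneg s, abs_nonneg t]
  have hst' := abs_le.1 hstle
  have hgle : |g| ≤ 1 / 2 := by
    rw [abs_le, hg]
    constructor <;> nlinarith [sq_nonneg s, sq_nonneg t]
  have h3 : |s * t * (s - t) * g| ≤ 1 / 8 * |s - t| := by
    rw [abs_mul, abs_mul]
    calc |s * t| * |s - t| * |g| ≤ 1 / 4 * |s - t| * (1 / 2) := by gcongr
      _ = _ := by ring
  have h2 : |s * t * Real.log (s / t) / 2| ≤ 1 / 4 * |s - t| := by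
    rw [abs_div, abs_mul, abs_two]
    linarith
  have h1 : |s * t * (abelFun s - abelFun t)| = |s| * |t| * |abelFun s - abelFun t| := by
    rw [abs_mul, abs_mul]
  have h4 : |t - s| ≤ |s * t * (abelFun s - abelFun t)| + |s * t * Real.log (s / t) / 2|
      + |s * t * (s - t) * g| := by
    rw [hid]
    exact (abs_sub _ _).trans (add_le_add_left (abs_sub _ _) _)
  rw [abs_sub_comm t s] at h4
  nlinarith [abs_nonneg (s - t)]

end AbelFunction

/-! ### Summing increments, and the a priori bound O(1/n). -/

section Sequences

theorem inv_pow_five_le (x : ℝ) (hx : 1 ≤ x) :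
    1 / x ^ 5 ≤ 4 * (1 / x ^ 4 - 1 / (x + 1) ^ 4) := by
  have hx0 : 0 < x := by linarith
  rw [div_sub_div _ _ (by positivity) (by positivity), mul_div_assoc', div_le_div_iff₀
    (by positivity) (by positivity)]
  have h1 : (x + 1) ^ 4 ≤ 16 * x ^ 4 :=
    calc (x + 1) ^ 4 ≤ (2 * x) ^ 4 := by gcongr; linarith
      _ = _ := by ring
  have h2 : 4 * x ^ 3 ≤ (x + 1) ^ 4 - x ^ 4 := by nlinarith [sq_nonneg x]
  have h3 : 16 * x ^ 4 ≤ 4 * ((x + 1) ^ 4 - x ^ 4) * x := by nlinarith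
  have h4 : 0 ≤ x ^ 4 := by positivity
  nlinarith [mul_le_mul_of_nonneg_left (h1.trans h3) h4]

/-- The increments are dominated by the telescoping differences of 4A/n^4. This makes the sequence
Cauchy and bounds its distance from the limit. -/
theorem exists_sub_isBigO_of_diff_isBigO {u : ℕ → ℝ}
    (h : (fun n : ℕ => u (n + 1) - u n) =O[atTop] fun n : ℕ => 1 / (n : ℝ) ^ 5) :
    ∃ K, (fun n : ℕ => u n - K) =O[atTop] fun n : ℕ => 1 / (n : ℝ) ^ 4 := by
  obtain ⟨A, hA0, hA⟩ := h.exists_pos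
  obtain ⟨N₀, hN₀⟩ := eventually_atTop.1 hA.bound
  set N := max N₀ 1
  set g : ℕ → ℝ := fun n => 4 * A * (1 / (n : ℝ) ^ 4) with hg
  have hstep : ∀ n, N ≤ n → |u (n + 1) - u n| ≤ g n - g (n + 1) := by
    intro n hn
    have hn1 : (1 : ℝ) ≤ n := by exact_mod_cast (le_max_right N₀ 1).trans hn
    have h1 := hN₀ n ((le_max_left _ _).trans hn)
    rw [Real.norm_eq_abs, Real.norm_eq_abs, abs_of_nonneg (a := 1 / _) (by positivity)] at h1
    have h2 := mul_le_mul_of_nonneg_left (inv_pow_five_le n hn1) hA0.le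
    simp only [hg]
    push_cast
    linarith
  have htail : ∀ n, N ≤ n → ∀ m, n ≤ m → |u m - u n| ≤ g n - g m := by
    intro n hn m hm
    induction m, hm using Nat.le_induction with
    | base => simp
    | succ m hm ih =>
      have := hstep m (hn.trans hm)
      have h3 := abs_sub_le (u (m + 1)) (u m) (u n)
      linarith
  have hgpos : ∀ n, 0 ≤ g n := fun n => by positivity
  have hg0 : Tendsto g atTop (nhds 0) := by
    have h1 : Tendsto (fun n : ℕ => 1 / (n : ℝ) ^ 4) atTop (nhds 0) := by
      simp only [one_div]
      exact ((tendsto_pow_atTop (by norm_num : (4 : ℕ) ≠ 0)).comp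
        tendsto_natCast_atTop_atTop).inv_tendsto_atTop
    simpa only [mul_zero] using h1.const_mul (4 * A)
  have hcau : CauchySeq u := by
    rw [Metric.cauchySeq_iff']
    intro ε hε
    obtain ⟨M, hM⟩ := eventually_atTop.1 (hg0.eventually (gt_mem_nhds hε))
    refine ⟨max M N, fun n hn => ?_⟩
    rw [Real.dist_eq]
    have h1 := htail _ (le_max_right M N) n hn
    have h2 := hM _ (le_max_left M N)
    linarith [hgpos n]
  obtain ⟨K, hK⟩ := cauchySeq_tendsto_of_complete hcau
  refine ⟨K, IsBigO.of_bound (4 * A) (eventually_atTop.2 ⟨N, fun n hn => ?_⟩)⟩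
  have hlim : Tendsto (fun m => |u m - u n|) atTop (nhds |K - u n|) :=
    (hK.sub_const _).abs
  -- Let m tend to infinity in `htail`, discarding the nonnegative g m.
  have hle : |K - u n| ≤ g n := le_of_tendsto hlim
    (eventually_atTop.2 ⟨n, fun m hm => by linarith [htail n hn m hm, hgpos m]⟩)
  rw [Real.norm_eq_abs, Real.norm_eq_abs, abs_sub_comm, abs_of_nonneg (a := 1 / _) (by positivity)]
  exact hle

/-- The reciprocals grow at least linearly. -/
theorem isBigO_inv_of_inv_add_le {x : ℕ → ℝ} {c : ℝ} (hc : 0 < c) (hx : ∀ n, 0 < x n)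
    (h : ∀ n, 1 / x n + c ≤ 1 / x (n + 1)) : x =O[atTop] fun n : ℕ => 1 / (n : ℝ) := by
  have hlin : ∀ n : ℕ, c * n ≤ 1 / x n := by
    intro n
    induction n with
    | zero => simpa using (hx 0).le
    | succ n ih =>
      push_cast
      linarith [h n]
  refine IsBigO.of_bound (1 / c) (eventually_atTop.2 ⟨1, fun n hn => ?_⟩)
  have hn' : (0 : ℝ) < n := by exact_mod_cast hn
  rw [Real.norm_eq_abs, Real.norm_eq_abs, abs_of_pos (hx n), abs_of_pos (by positivity)]
  have h1 := one_div_le_one_div_of_le (by positivity) (hlin n)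
  rw [one_div_one_div] at h1
  exact h1.trans_eq (by field_simp)

end Sequences

/-! ### Formal inversion of the Abel function, graded by weight. -/

section Inversion

/-- The sum `u ↦ P₁ + P₂ + P₃ + P₄` of the polynomials for `Z`, homogenized by the variable `e`. -/
noncomputable def homSum (u e : ℝ) : ℝ :=
  u + (u ^ 2 + 1 / 2 * u * e + 1 / 6 * e ^ 2) +
    (u ^ 3 + 5 / 4 * u ^ 2 * e + 3 / 4 * u * e ^ 2 + 7 / 48 * e ^ 3) +
    (u ^ 4 + 13 / 6 * u ^ 3 * e + 17 / 8 * u ^ 2 * e ^ 2 + 23 / 24 * u * e ^ 3 +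
      707 / 4320 * e ^ 4)

theorem log_one_add_sub_isBigO :
    (fun x : ℝ => Real.log (1 + x) - (x - x ^ 2 / 2 + x ^ 3 / 3)) =O[nhds 0] fun x => x ^ 4 := by
  refine IsBigO.of_bound 2 ?_
  have h : ∀ᶠ x : ℝ in nhds 0, |x| < 1 / 2 := by
    have := (continuous_abs.tendsto (0 : ℝ)).eventually
      (gt_mem_nhds (show |(0 : ℝ)| < 1 / 2 by norm_num))
    exact this
  filter_upwards [h] with x hx
  have h1 := Real.abs_log_sub_add_sum_range_le (x := -x) (by rw [abs_neg]; linarith) 3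
  rw [abs_neg] at h1
  have h2 : ∑ i ∈ Finset.range 3, (-x) ^ (i + 1) / ((i : ℝ) + 1) + Real.log (1 - -x) =
      Real.log (1 + x) - (x - x ^ 2 / 2 + x ^ 3 / 3) := by
    norm_num [Finset.sum_range_succ]
    ring
  rw [h2] at h1
  rw [Real.norm_eq_abs, Real.norm_eq_abs, abs_pow]
  refine h1.trans ?_
  rw [div_le_iff₀ (by linarith)]
  rw [show 3 + 1 = 4 from rfl]
  nlinarith [mul_nonneg (pow_nonneg (abs_nonneg x) 4) (sub_nonneg.2 hx.le)]

theorem isBigO_norm_pow_mono {m n : ℕ} (h : m ≤ n) {f : ℝ × ℝ → ℝ}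
    (hf : f =O[nhds 0] fun p => ‖p‖ ^ n) : f =O[nhds 0] fun p => ‖p‖ ^ m := by
  refine hf.trans (IsBigO.of_bound 1 ?_)
  filter_upwards [Metric.ball_mem_nhds (0 : ℝ × ℝ) one_pos] with p hp
  rw [mem_ball_zero_iff] at hp
  rw [one_mul, norm_pow, norm_pow, norm_norm]
  exact pow_le_pow_of_le_one (norm_nonneg _) hp.le h

theorem isBigO_norm_pow_mul {i j k : ℕ} (h : k ≤ i + j) {f g : ℝ × ℝ → ℝ}
    (hf : f =O[nhds 0] fun p => ‖p‖ ^ i) (hg : g =O[nhds 0] fun p => ‖p‖ ^ j) :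
    (fun p => f p * g p) =O[nhds 0] fun p => ‖p‖ ^ k := by
  refine isBigO_norm_pow_mono h ?_
  simpa only [pow_add] using hf.mul hg

/-- With q = 1 + `homSum` u e, this is e times the equation abelFun(eq) = 1/e + K, where u absorbs
the terms in log|e| and K. Giving u and e weight 1 each, P_1, ..., P_4 are what make the parts of
weight at most 4 vanish. -/
theorem homSum_equation_isBigO :
    (fun p : ℝ × ℝ => 1 / (1 + homSum p.1 p.2) - 1 + p.1
      + p.2 / 2 * Real.log (1 + homSum p.1 p.2) + 1 / 6 * p.2 ^ 2 * (1 + homSum p.1 p.2)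
      + 1 / 16 * p.2 ^ 3 * (1 + homSum p.1 p.2) ^ 2
      + 19 / 540 * p.2 ^ 4 * (1 + homSum p.1 p.2) ^ 3) =O[nhds 0] fun p => ‖p‖ ^ 5 := by
  have hu : (fun p : ℝ × ℝ => p.1) =O[nhds 0] fun p => ‖p‖ ^ 1 :=
    IsBigO.of_bound 1 (Eventually.of_forall fun p => by simpa using norm_fst_le p)
  have he : (fun p : ℝ × ℝ => p.2) =O[nhds 0] fun p => ‖p‖ ^ 1 :=
    IsBigO.of_bound 1 (Eventually.of_forall fun p => by simpa using norm_snd_le p)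
  have hmon : ∀ i j, (fun p : ℝ × ℝ => p.1 ^ i * p.2 ^ j) =O[nhds 0] fun p => ‖p‖ ^ (i + j) := by
    intro i j
    simpa [pow_add, ← pow_mul] using (hu.pow i).mul (he.pow j)
  have hmonc : ∀ (c : ℝ) (i j : ℕ),
      (fun p : ℝ × ℝ => c * (p.1 ^ i * p.2 ^ j)) =O[nhds 0] fun p => ‖p‖ ^ (i + j) :=
    fun c i j => (hmon i j).const_mul_left c
  set d2 : ℝ × ℝ → ℝ := fun p => p.1 ^ 2 + 1 / 2 * p.1 * p.2 + 1 / 6 * p.2 ^ 2 with hd2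
  set d3 : ℝ × ℝ → ℝ := fun p =>
    p.1 ^ 3 + 5 / 4 * p.1 ^ 2 * p.2 + 3 / 4 * p.1 * p.2 ^ 2 + 7 / 48 * p.2 ^ 3 with hd3
  set d4 : ℝ × ℝ → ℝ := fun p => p.1 ^ 4 + 13 / 6 * p.1 ^ 3 * p.2 + 17 / 8 * p.1 ^ 2 * p.2 ^ 2 +
    23 / 24 * p.1 * p.2 ^ 3 + 707 / 4320 * p.2 ^ 4 with hd4
  have hd2O : d2 =O[nhds 0] fun p => ‖p‖ ^ 2 :=
    (((hmonc 1 2 0).add (hmonc (1 / 2) 1 1)).add (hmonc (1 / 6) 0 2)).congr_left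
      fun p => by simp only [hd2]; ring
  have hd3O : d3 =O[nhds 0] fun p => ‖p‖ ^ 3 :=
    ((((hmonc 1 3 0).add (hmonc (5 / 4) 2 1)).add (hmonc (3 / 4) 1 2)).add
      (hmonc (7 / 48) 0 3)).congr_left fun p => by simp only [hd3]; ring
  have hd4O : d4 =O[nhds 0] fun p => ‖p‖ ^ 4 :=
    (((((hmonc 1 4 0).add (hmonc (13 / 6) 3 1)).add (hmonc (17 / 8) 2 2)).add
      (hmonc (23 / 24) 1 3)).add (hmonc (707 / 4320) 0 4)).congr_left
      fun p => by simp only [hd4]; ring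
  set d : ℝ × ℝ → ℝ := fun p => homSum p.1 p.2 with hd
  set r2 : ℝ × ℝ → ℝ := fun p => d2 p + d3 p + d4 p with hr2
  set r3 : ℝ × ℝ → ℝ := fun p => d3 p + d4 p with hr3
  have hdr : ∀ p, d p = p.1 + r2 p := fun p => by
    simp only [hd, hr2, hd2, hd3, hd4, homSum]; ring
  have hr3O : r3 =O[nhds 0] fun p => ‖p‖ ^ 3 :=
    hd3O.add (isBigO_norm_pow_mono (by norm_num) hd4O)
  have hr2O : r2 =O[nhds 0] fun p => ‖p‖ ^ 2 :=
    (hd2O.add (isBigO_norm_pow_mono (by norm_num) hd3O)).add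
      (isBigO_norm_pow_mono (by norm_num) hd4O)
  have hdO : d =O[nhds 0] fun p => ‖p‖ ^ 1 :=
    (hu.add (isBigO_norm_pow_mono (by norm_num) hr2O)).congr_left fun p => (hdr p).symm
  have hdcont : Continuous d := by
    simp only [hd, homSum]
    fun_prop
  have hd0 : d 0 = 0 := by simp [hd, homSum]
  have hdlim : Tendsto d (nhds 0) (nhds 0) := by
    simpa [hd0] using hdcont.tendsto 0
  have hqlim : Tendsto (fun p => 1 + d p) (nhds 0) (nhds 1) := by
    simpa using hdlim.const_add 1
  have hqO : (fun p => 1 + d p) =O[nhds 0] fun p => ‖p‖ ^ 0 := by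
    simpa using hqlim.isBigO_one ℝ
  have hqinv : (fun p => 1 / (1 + d p)) =O[nhds 0] fun p => ‖p‖ ^ 0 := by
    have := hqlim.inv₀ one_ne_zero
    simpa using this.isBigO_one ℝ
  have hd2' : (fun p => d p ^ 2) =O[nhds 0] fun p => ‖p‖ ^ 2 := by
    simpa [← pow_mul] using hdO.pow 2
  have hd3' : (fun p => d p ^ 3) =O[nhds 0] fun p => ‖p‖ ^ 3 := by
    simpa [← pow_mul] using hdO.pow 3
  have hd4' : (fun p => d p ^ 4) =O[nhds 0] fun p => ‖p‖ ^ 4 := by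
    simpa [← pow_mul] using hdO.pow 4
  set R : ℝ × ℝ → ℝ := fun p => Real.log (1 + d p) - (d p - d p ^ 2 / 2 + d p ^ 3 / 3) with hR
  have hRO : R =O[nhds 0] fun p => ‖p‖ ^ 4 := (log_one_add_sub_isBigO.comp_tendsto hdlim).trans hd4'
  have he2 := hmon 0 2
  have he3 := hmon 0 3
  have he4 := hmon 0 4
  simp only [pow_zero, one_mul, zero_add] at he2 he3 he4
  -- The remainder of weight at least `5` of `1 + d` times the left-hand side.
  have t1 := isBigO_norm_pow_mul (k := 5) (by norm_num) hu hd4O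
  -- Here (1 + d) log(1 + d) = d + d^2/2 - d^3/6 + d^4/3 + (1 + d)R; the bracket is what remains
  -- after removing the weights up to 3.
  have t2 : (fun p : ℝ × ℝ => p.2 * (d4 p + p.1 * r3 p + r2 p ^ 2 / 2
      - r2 p * (d p ^ 2 + d p * p.1 + p.1 ^ 2) / 6 + d p ^ 4 / 3 + (1 + d p) * R p)) =O[nhds 0]
      fun p => ‖p‖ ^ 5 := by
    refine isBigO_norm_pow_mul (i := 1) (j := 4) (by norm_num) he ?_
    have s1 := isBigO_norm_pow_mul (k := 4) (by norm_num) hu hr3O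
    have s2 := (isBigO_norm_pow_mul (k := 4) (by norm_num) hr2O hr2O).const_mul_left (1 / 2)
    have hmix : (fun p : ℝ × ℝ => d p ^ 2 + d p * p.1 + p.1 ^ 2) =O[nhds 0] fun p => ‖p‖ ^ 2 :=
      ((hd2'.add (isBigO_norm_pow_mul (by norm_num) hdO hu)).add
        (isBigO_norm_pow_mul (by norm_num) hu hu)).congr_left fun p => by ring
    have s3 := (isBigO_norm_pow_mul (k := 4) (by norm_num) hr2O hmix).const_mul_left (-1 / 6)
    have s4 := hd4'.const_mul_left (1 / 3)
    have s5 := isBigO_norm_pow_mul (k := 4) (by norm_num) hqO hRO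
    exact (((((hd4O.add s1).add s2).add s3).add s4).add s5).congr_left fun p => by ring
  have t3 : (fun p : ℝ × ℝ => p.2 ^ 2 * (2 * r3 p + r2 p * (d p + p.1))) =O[nhds 0]
      fun p => ‖p‖ ^ 5 :=
    isBigO_norm_pow_mul (by norm_num) he2 ((hr3O.const_mul_left 2).add
      (isBigO_norm_pow_mul (by norm_num) hr2O (hdO.add hu)))
  have t4 : (fun p : ℝ × ℝ => p.2 ^ 3 * (3 * r2 p + 3 * d p ^ 2 + d p ^ 3)) =O[nhds 0]
      fun p => ‖p‖ ^ 5 :=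
    isBigO_norm_pow_mul (by norm_num) he3 (((hr2O.const_mul_left 3).add
      (hd2'.const_mul_left 3)).add (isBigO_norm_pow_mono (by norm_num) hd3'))
  have t5 : (fun p : ℝ × ℝ => p.2 ^ 4 * (4 * d p + 6 * d p ^ 2 + 4 * d p ^ 3 + d p ^ 4)) =O[nhds 0]
      fun p => ‖p‖ ^ 5 :=
    isBigO_norm_pow_mul (by norm_num) he4 ((((hdO.const_mul_left 4).add
      (isBigO_norm_pow_mono (by norm_num) (hd2'.const_mul_left 6))).add
      (isBigO_norm_pow_mono (by norm_num) (hd3'.const_mul_left 4))).add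
      (isBigO_norm_pow_mono (by norm_num) hd4'))
  have hsum := (((t1.add (t2.const_mul_left (1 / 2))).add (t3.const_mul_left (1 / 6))).add
    (t4.const_mul_left (1 / 16))).add (t5.const_mul_left (19 / 540))
  refine (isBigO_norm_pow_mul (k := 5) (by norm_num) hqinv hsum).congr' ?_ .rfl
  filter_upwards [hqlim.eventually_ne one_ne_zero] with p hp
  -- The exact identity behind the cancellation: the terms of weight at most 4 on the right sum to
  -- zero once d_2, d_3, d_4 are inserted.
  have hpoly : p.1 * d4 p + 1 / 2 * (p.2 * (d4 p + p.1 * r3 p + r2 p ^ 2 / 2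
      - r2 p * (d p ^ 2 + d p * p.1 + p.1 ^ 2) / 6 + d p ^ 4 / 3 + (1 + d p) * R p))
      + 1 / 6 * (p.2 ^ 2 * (2 * r3 p + r2 p * (d p + p.1)))
      + 1 / 16 * (p.2 ^ 3 * (3 * r2 p + 3 * d p ^ 2 + d p ^ 3))
      + 19 / 540 * (p.2 ^ 4 * (4 * d p + 6 * d p ^ 2 + 4 * d p ^ 3 + d p ^ 4)) =
      -d p + p.1 * (1 + d p) + p.2 / 2 * ((1 + d p) * Real.log (1 + d p))
      + 1 / 6 * p.2 ^ 2 * (1 + d p) ^ 2 + 1 / 16 * p.2 ^ 3 * (1 + d p) ^ 3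
      + 19 / 540 * p.2 ^ 4 * (1 + d p) ^ 4 := by
    simp only [hR, hdr, hr2, hr3]
    simp only [hd2, hd3, hd4]
    ring
  rw [hpoly]
  change _ = 1 / (1 + d p) - 1 + p.1 + p.2 / 2 * Real.log (1 + d p) + 1 / 6 * p.2 ^ 2 * (1 + d p)
      + 1 / 16 * p.2 ^ 3 * (1 + d p) ^ 2 + 19 / 540 * p.2 ^ 4 * (1 + d p) ^ 3
  field_simp
  ring

end Inversion

/-! ### Asymptotics of the orbits. -/

section Iterates

theorem tendsto_log_div_natCast :
    Tendsto (fun n : ℕ => Real.log n / (n : ℝ)) atTop (nhds 0) := by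
  have h := (Real.isLittleO_log_id_atTop.comp_tendsto tendsto_natCast_atTop_atTop).tendsto_div_nhds_zero
  simpa [Function.comp_def] using h

theorem one_le_log_natCast : ∀ᶠ n : ℕ in atTop, 1 ≤ Real.log n :=
  (Real.tendsto_log_atTop.comp tendsto_natCast_atTop_atTop).eventually_ge_atTop 1

/-- Inversion of `abelFun s = N + K`, where `N = n` or `N = -n`. -/
theorem sub_homSum_isBigO {σ : ℝ} (hσ : σ ^ 2 = 1) {s : ℕ → ℝ} (hs : ∀ n, 0 < σ * s n)
    (hsO : s =O[atTop] fun n : ℕ => 1 / (n : ℝ)) {K : ℝ}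
    (hK : (fun n : ℕ => abelFun (s n) - (σ * n + K)) =O[atTop] fun n : ℕ => 1 / (n : ℝ) ^ 4) :
    (fun n : ℕ => s n - σ / n * (1 + homSum (-(Real.log n / 2 + K) * (σ / n)) (σ / n)))
      =O[atTop] fun n : ℕ => Real.log n ^ 5 / (n : ℝ) ^ 6 := by
  have hσ0 : σ ≠ 0 := by rintro rfl; norm_num at hσ
  have hσabs : |σ| = 1 := by
    rw [← sq_abs] at hσ
    exact (pow_eq_one_iff_of_nonneg (abs_nonneg _) two_ne_zero).1 hσ
  set ρ : ℕ → ℝ := fun n => Real.log n / (n : ℝ) with hρ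
  set p : ℕ → ℝ × ℝ := fun n => (-(Real.log n / 2 + K) * (σ / n), σ / n) with hp
  set q : ℕ → ℝ := fun n => 1 + homSum (p n).1 (p n).2 with hq
  have hev := one_le_log_natCast
  have hpos := eventually_gt_atTop (α := ℕ) 0
  have hpO : p =O[atTop] ρ := by
    refine IsBigO.of_bound (1 + |K|) ?_
    filter_upwards [hev, hpos] with n hn hn0
    have hn' : (0 : ℝ) < n := by exact_mod_cast hn0
    have hdiv : |σ / (n : ℝ)| = 1 / n := by rw [abs_div, hσabs, abs_of_pos hn']
    have hρn : ‖ρ n‖ = Real.log n / n := by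
      rw [Real.norm_eq_abs, abs_of_nonneg (by positivity)]
    rw [hρn, Prod.norm_def, Real.norm_eq_abs, Real.norm_eq_abs, abs_mul, hdiv]
    have h1 : |-(Real.log n / 2 + K)| ≤ (1 + |K|) * Real.log n := by
      rw [abs_neg]
      refine (abs_add_le _ _).trans ?_
      rw [abs_of_nonneg (by positivity)]
      nlinarith [abs_nonneg K]
    have h2 : 1 ≤ (1 + |K|) * Real.log n := by nlinarith [abs_nonneg K]
    refine max_le ?_ ?_
    · calc _ ≤ (1 + |K|) * Real.log n * (1 / n) := by gcongr
        _ = _ := by ring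
    · calc 1 / (n : ℝ) ≤ (1 + |K|) * Real.log n * (1 / n) :=
          le_mul_of_one_le_left (by positivity) h2
        _ = _ := by ring
  have hp0 : Tendsto p atTop (nhds 0) := hpO.trans_tendsto tendsto_log_div_natCast
  have hF : (fun n => 1 / q n - 1 + (p n).1 + (p n).2 / 2 * Real.log (q n)
      + 1 / 6 * (p n).2 ^ 2 * q n + 1 / 16 * (p n).2 ^ 3 * q n ^ 2
      + 19 / 540 * (p n).2 ^ 4 * q n ^ 3) =O[atTop] fun n => ρ n ^ 5 :=
    (homSum_equation_isBigO.comp_tendsto hp0).trans (hpO.norm_left.pow 5)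
  have hqlim : Tendsto q atTop (nhds 1) := by
    have hc : Continuous fun p : ℝ × ℝ => 1 + homSum p.1 p.2 := by
      unfold homSum
      fun_prop
    have h0 : 1 + homSum (0 : ℝ × ℝ).1 (0 : ℝ × ℝ).2 = 1 := by simp [homSum]
    have := (hc.tendsto 0).comp hp0
    rwa [h0] at this
  have hqpos : ∀ᶠ n in atTop, 0 < q n := hqlim.eventually (lt_mem_nhds one_pos)
  set t : ℕ → ℝ := fun n => σ / n * q n with ht
  have hinv : (fun n : ℕ => σ / (n : ℝ)) =O[atTop] fun n : ℕ => 1 / (n : ℝ) :=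
    (isBigO_const_mul_self σ (fun n : ℕ => 1 / (n : ℝ)) atTop).congr_left fun n => by ring
  have htO : t =O[atTop] fun n : ℕ => 1 / (n : ℝ) := by
    simpa using hinv.mul (hqlim.isBigO_one ℝ)
  have hinv0 : Tendsto (fun n : ℕ => 1 / (n : ℝ)) atTop (nhds 0) := tendsto_one_div_atTop_nhds_zero_nat
  have hsmall : ∀ v : ℕ → ℝ, v =O[atTop] (fun n : ℕ => 1 / (n : ℝ)) →
      ∀ᶠ n in atTop, |v n| ≤ 1 / 2 := by
    intro v hv
    have h0 := (hv.trans_tendsto hinv0).abs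
    rw [abs_zero] at h0
    exact (h0.eventually (gt_mem_nhds (by norm_num : (0 : ℝ) < 1 / 2))).mono fun n hn => le_of_lt hn
  -- The error in K is smaller than the inversion error, because ln n ≥ 1 eventually.
  have hρ4 : (fun n : ℕ => 1 / (n : ℝ) ^ 4) =O[atTop] fun n : ℕ => (n : ℝ) * ρ n ^ 5 := by
    refine IsBigO.of_bound 1 ?_
    filter_upwards [hev, hpos] with n hn hn0
    have hn' : (0 : ℝ) < n := by exact_mod_cast hn0
    rw [one_mul, Real.norm_eq_abs, Real.norm_eq_abs, abs_of_nonneg (by positivity),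
      abs_of_nonneg (by positivity)]
    calc 1 / (n : ℝ) ^ 4 ≤ Real.log n ^ 5 / (n : ℝ) ^ 4 := by
          gcongr
          exact one_le_pow₀ hn
      _ = _ := by
          simp only [hρ]
          field_simp
  -- Since σ^2 = 1, division by σ/n is multiplication by σn, which costs one factor n.
  have hpsi_t : (fun n : ℕ => abelFun (t n) - (σ * n + K)) =O[atTop]
      fun n : ℕ => (n : ℝ) * ρ n ^ 5 := by
    have h1 : (fun n : ℕ => σ * (n : ℝ)) =O[atTop] fun n : ℕ => (n : ℝ) :=
      isBigO_const_mul_self _ _ _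
    refine (h1.mul hF).congr' ?_ .rfl
    filter_upwards [hqpos, hpos] with n hqn hn0
    have hn' : (n : ℝ) ≠ 0 := by positivity
    -- The sign σ disappears because `Real.log` depends only on the absolute value.
    have hlog : Real.log (σ / n * q n) = -Real.log n + Real.log (q n) := by
      rw [Real.log_mul (div_ne_zero hσ0 hn') hqn.ne', Real.log_div hσ0 hn', ← Real.log_abs σ, hσabs,
        Real.log_one, zero_sub]
    simp only [ht, abelFun, hlog]
    simp only [hp]
    have hσinv : 1 / (σ / n * q n) = σ * n * (1 / q n) := by
      field_simp
      linear_combination -hσ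
    rw [hσinv]
    have hσn : σ * n * (σ / n) = 1 := by
      field_simp
      exact hσ
    linear_combination (-(Real.log n / 2 + K) + Real.log (q n) / 2 + 1 / 6 * (σ / n) * q n
      + 1 / 16 * (σ / n) ^ 2 * q n ^ 2 + 19 / 540 * (σ / n) ^ 3 * q n ^ 3) * hσn
  have hdiff : (fun n => abelFun (s n) - abelFun (t n)) =O[atTop]
      fun n : ℕ => (n : ℝ) * ρ n ^ 5 :=
    ((hK.trans hρ4).sub hpsi_t).congr_left fun n => by ring
  have hmain : (fun n => s n - t n) =O[atTop]
      fun n => s n * t n * (abelFun (s n) - abelFun (t n)) := by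
    refine IsBigO.of_bound 2 ?_
    filter_upwards [hsmall s hsO, hsmall t htO, hqpos, hpos] with n h1 h2 h3 hn0
    have hn' : (0 : ℝ) < n := by exact_mod_cast hn0
    have hst : 0 < s n * t n := by
      simp only [ht]
      rw [show s n * (σ / n * q n) = σ * s n * (q n / n) by ring]
      exact mul_pos (hs n) (div_pos h3 hn')
    rw [Real.norm_eq_abs, Real.norm_eq_abs, abs_mul, abs_mul]
    exact abs_sub_le_abelFun hst h1 h2
  -- The orders multiply to n^{-2} · n · (ln n/n)^5 = (ln n)^5/n^6.
  refine hmain.trans (((hsO.mul htO).mul hdiff).congr' .rfl ?_)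
  filter_upwards [hpos] with n hn0
  have hn' : (n : ℝ) ≠ 0 := by positivity
  simp only [hρ]
  field_simp

theorem inv_natCast_pow_five_isBigO {s : ℕ → ℝ}
    (hsO : s =O[atTop] fun n : ℕ => 1 / (n : ℝ)) :
    (fun n => s n ^ 5) =O[atTop] fun n : ℕ => 1 / (n : ℝ) ^ 5 := by
  simpa using hsO.pow 5

theorem tendsto_nhdsNE_zero {s : ℕ → ℝ} (hs : ∀ n, s n ≠ 0)
    (hsO : s =O[atTop] fun n : ℕ => 1 / (n : ℝ)) :
    Tendsto s atTop (nhdsWithin 0 {0}ᶜ) :=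
  tendsto_nhdsWithin_iff.2 ⟨hsO.trans_tendsto tendsto_one_div_atTop_nhds_zero_nat,
    Eventually.of_forall hs⟩

theorem iterate_Z_sub_homSum_isBigO {x₀ : ℝ} (hx₀ : 0 < x₀) : ∃ K : ℝ,
    (fun n : ℕ => Z^[n] x₀ -
      1 / n * (1 + homSum (-(Real.log n / 2 + K) * (1 / n)) (1 / n)))
      =O[atTop] fun n : ℕ => Real.log n ^ 5 / (n : ℝ) ^ 6 := by
  set x : ℕ → ℝ := fun n => Z^[n] x₀ with hx
  have hsucc : ∀ n, x (n + 1) = Z (x n) := fun n => Function.iterate_succ_apply' Z n x₀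
  have hpos : ∀ n, 0 < x n := by
    intro n
    induction n with
    | zero => exact hx₀
    | succ n ih =>
      rw [hsucc]
      exact mul_pos ih (Real.exp_pos _)
  have hO : x =O[atTop] fun n : ℕ => 1 / (n : ℝ) := by
    -- For Z the reciprocal grows by at least 1 per step: exp(x)/x ≥ (1 + x)/x.
    refine isBigO_inv_of_inv_add_le one_pos hpos fun n => ?_
    have hxn := hpos n
    rw [hsucc, Z, Real.exp_neg, ← div_eq_mul_inv, one_div_div, div_add_one hxn.ne']
    gcongr
    linarith [Real.add_one_le_exp (x n)]
  have hdiff : (fun n : ℕ => (abelFun (x (n + 1)) - ((n + 1 : ℕ) : ℝ)) - (abelFun (x n) - n))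
      =O[atTop] fun n : ℕ => 1 / (n : ℝ) ^ 5 := by
    refine ((abelFun_Z_sub_isBigO.comp_tendsto
      (tendsto_nhdsNE_zero (fun n => (hpos n).ne') hO)).trans
      (inv_natCast_pow_five_isBigO hO)).congr_left fun n => ?_
    simp only [Function.comp_def, hsucc]
    push_cast
    ring
  obtain ⟨K, hK⟩ := exists_sub_isBigO_of_diff_isBigO
    (u := fun n : ℕ => abelFun (x n) - (n : ℝ)) hdiff
  refine ⟨K, sub_homSum_isBigO (σ := 1) (by norm_num) (by simpa using hpos) hO
    (hK.congr_left fun n => by ring)⟩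

theorem iterate_lambertW_sub_homSum_isBigO {x₀ : ℝ} (hx₀ : 0 < x₀) : ∃ K : ℝ,
    (fun n : ℕ => -lambertW^[n] x₀ -
      -1 / n * (1 + homSum (-(Real.log n / 2 + K) * (-1 / n)) (-1 / n)))
      =O[atTop] fun n : ℕ => Real.log n ^ 5 / (n : ℝ) ^ 6 := by
  set x : ℕ → ℝ := fun n => lambertW^[n] x₀ with hx
  have hsucc : ∀ n, x (n + 1) = lambertW (x n) :=
    fun n => Function.iterate_succ_apply' lambertW n x₀
  have hpos : ∀ n, 0 < x n := by
    intro n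
    induction n with
    | zero => exact hx₀
    | succ n ih =>
      rw [hsucc]
      exact (lambertW_pos_and_mul_exp ih).1
  have hrec : ∀ n, x (n + 1) * Real.exp (x (n + 1)) = x n := fun n => by
    rw [hsucc]
    exact (lambertW_pos_and_mul_exp (hpos n)).2
  have hle : ∀ n, x n ≤ x₀ := by
    intro n
    induction n with
    | zero => exact le_rfl
    | succ n ih =>
      refine le_trans ?_ ih
      rw [← hrec n]
      exact le_mul_of_one_le_right (hpos _).le (Real.one_le_exp (hpos _).le)
  have hO : x =O[atTop] fun n : ℕ => 1 / (n : ℝ) := by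
    -- With y = x_{n+1}, the inequality 1 + y ≤ exp(y) yields a gain of at least exp(-y), and y ≤
    -- x_0 makes this uniform.
    refine isBigO_inv_of_inv_add_le (Real.exp_pos (-x₀)) hpos fun n => ?_
    have hy := hpos (n + 1)
    have hE := Real.exp_pos (x (n + 1))
    have h1 : Real.exp (-x₀) ≤ Real.exp (-x (n + 1)) :=
      Real.exp_le_exp.2 (neg_le_neg (hle (n + 1)))
    have h2 : 1 / x n + Real.exp (-x (n + 1)) =
        (1 + x (n + 1)) / (x (n + 1) * Real.exp (x (n + 1))) := by
      rw [← hrec n, Real.exp_neg]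
      field_simp
    have h3 : (1 + x (n + 1)) / (x (n + 1) * Real.exp (x (n + 1))) ≤ 1 / x (n + 1) := by
      rw [div_le_div_iff₀ (by positivity) hy]
      nlinarith [Real.add_one_le_exp (x (n + 1))]
    linarith
  have hO' : (fun n => -x n) =O[atTop] fun n : ℕ => 1 / (n : ℝ) := hO.neg_left
  have hshift : (fun n => -x (n + 1)) =O[atTop] fun n : ℕ => 1 / (n : ℝ) := by
    refine (hO'.comp_tendsto (tendsto_add_atTop_nat 1)).trans (IsBigO.of_bound 1 ?_)
    filter_upwards [eventually_gt_atTop 0] with n hn0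
    have hn' : (0 : ℝ) < n := by exact_mod_cast hn0
    simp only [Function.comp_def]
    push_cast
    rw [one_mul, Real.norm_eq_abs, Real.norm_eq_abs, abs_of_pos (by positivity),
      abs_of_pos (by positivity)]
    gcongr
    linarith
  have hZ : ∀ n, Z (-x (n + 1)) = -x n := fun n => by
    rw [Z, neg_neg, neg_mul, hrec]
  -- Abel's equation is used at -x_{n+1}, whose image under Z is -x_n. The orbit runs backward, so n
  -- is added and the estimate is negated.
  have hdiff : (fun n : ℕ => (abelFun (-x (n + 1)) + ((n + 1 : ℕ) : ℝ)) - (abelFun (-x n) + n))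
      =O[atTop] fun n : ℕ => 1 / (n : ℝ) ^ 5 := by
    refine ((abelFun_Z_sub_isBigO.comp_tendsto
      (tendsto_nhdsNE_zero (fun n => (neg_neg_of_pos (hpos _)).ne) hshift)).trans
      (inv_natCast_pow_five_isBigO hshift)).neg_left.congr_left fun n => ?_
    simp only [Function.comp_def, hZ]
    push_cast
    ring
  obtain ⟨K, hK⟩ := exists_sub_isBigO_of_diff_isBigO
    (u := fun n : ℕ => abelFun (-x n) + (n : ℝ)) hdiff
  exact ⟨K, sub_homSum_isBigO (σ := -1) (by norm_num) (by simpa using hpos) hO'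
    (hK.congr_left fun n => by ring)⟩

end Iterates

/-! ### Translation into the general expansion formulas. -/

section Expansions

theorem expansion_aZ {x : ℕ → ℝ} {K : ℝ}
    (h : (fun n : ℕ => x n - 1 / n * (1 + homSum (-(Real.log n / 2 + K) * (1 / n)) (1 / n)))
      =O[atTop] fun n : ℕ => Real.log n ^ 5 / (n : ℝ) ^ 6) : Expansion 1 aZ 4 x K := by
  refine h.congr' ?_ ?_
  · filter_upwards [eventually_gt_atTop 0] with n hn0
    have hn' : (n : ℝ) ≠ 0 := by positivity
    norm_num [lam_aZ, Finset.sum_Icc_succ_top, eval_P_aZ_1, eval_P_aZ_2, eval_P_aZ_3, eval_P_aZ_4,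
      bCoef_aZ_1, homSum]
    field_simp
    exact Or.inl trivial
  · filter_upwards [eventually_gt_atTop 0] with n hn0
    have hn' : (n : ℝ) ≠ 0 := by positivity
    norm_num
    field_simp

/-- The substitution e = -1/n produces the factor (-1)^m by which P_m for W at the negated argument
differs from P_m for Z. The constant enters as -K, as formula (B) requires. -/
theorem expansion_aW {x : ℕ → ℝ} {K : ℝ}
    (h : (fun n : ℕ => -x n - -1 / n * (1 + homSum (-(Real.log n / 2 + K) * (-1 / n)) (-1 / n)))
      =O[atTop] fun n : ℕ => Real.log n ^ 5 / (n : ℝ) ^ 6) : Expansion 1 aW 4 x (-K) := by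
  refine h.neg_left.congr' ?_ ?_
  · filter_upwards [eventually_gt_atTop 0] with n hn0
    have hn' : (n : ℝ) ≠ 0 := by positivity
    norm_num [lam_aW, Finset.sum_Icc_succ_top, eval_P_aW_1, eval_P_aW_2, eval_P_aW_3, eval_P_aW_4,
      bCoef_aW_1, homSum]
    field_simp
    ring
  · filter_upwards [eventually_gt_atTop 0] with n hn0
    have hn' : (n : ℝ) ≠ 0 := by positivity
    norm_num
    field_simp

end Expansions

end IterAsymp

/-! ### Assembly of the theorem. -/

theorem mainTheorem12 :
    -- the Taylor coefficients of `Z` and the data derived from them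
    IterAsymp.HasTaylorStart IterAsymp.Z 1 IterAsymp.aZ ∧
    IterAsymp.lam 1 IterAsymp.aZ = 1 ∧
    (∀ j ∈ Finset.Icc 1 6, IterAsymp.bCoef 1 IterAsymp.aZ j = 1 / ((j + 1).factorial : ℝ)) ∧
    (∀ j ∈ Finset.Icc 1 6, IterAsymp.aCoef 1 IterAsymp.aZ 0 j = if j = 1 then 1 else 0) ∧
    (IterAsymp.cCoef 1 IterAsymp.aZ 1 = 1 / 6 ∧ IterAsymp.cCoef 1 IterAsymp.aZ 2 = 1 / 16 ∧
      IterAsymp.cCoef 1 IterAsymp.aZ 3 = 19 / 540 ∧ IterAsymp.cCoef 1 IterAsymp.aZ 4 = 1 / 48 ∧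
      IterAsymp.cCoef 1 IterAsymp.aZ 5 = 41 / 4200) ∧
    (IterAsymp.T 1 IterAsymp.aZ 1 = X ∧
      IterAsymp.T 1 IterAsymp.aZ 2 = C (1 / 2) * X - C (1 / 6) ∧
      IterAsymp.T 1 IterAsymp.aZ 3 = -C (1 / 4) * X ^ 2 + C (5 / 12) * X - C (7 / 48) ∧
      IterAsymp.T 1 IterAsymp.aZ 4 =
        C (1 / 6) * X ^ 3 - C (13 / 24) * X ^ 2 + C (1 / 2) * X - C (587 / 4320)) ∧
    (IterAsymp.P 1 IterAsymp.aZ 1 = X ∧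
      IterAsymp.P 1 IterAsymp.aZ 2 = X ^ 2 + C (1 / 2) * X + C (1 / 6) ∧
      IterAsymp.P 1 IterAsymp.aZ 3 = X ^ 3 + C (5 / 4) * X ^ 2 + C (3 / 4) * X + C (7 / 48) ∧
      IterAsymp.P 1 IterAsymp.aZ 4 =
        X ^ 4 + C (13 / 6) * X ^ 3 + C (17 / 8) * X ^ 2 + C (23 / 24) * X + C (707 / 4320)) ∧
    -- the expansion of the iterates of `Z`, in general form and written out
    (∀ x₀ : ℝ, 0 < x₀ → ∃ K : ℝ,
      IterAsymp.Expansion 1 IterAsymp.aZ 4 (fun n => IterAsymp.Z^[n] x₀) K ∧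
      (fun n : ℕ => IterAsymp.Z^[n] x₀ -
        (1 / (n : ℝ)
          - 1 / 2 * Real.log n / (n : ℝ) ^ 2
          - K / (n : ℝ) ^ 2
          + 1 / 4 * Real.log n ^ 2 / (n : ℝ) ^ 3
          + (K - 1 / 4) * Real.log n / (n : ℝ) ^ 3
          + (K ^ 2 - 1 / 2 * K + 1 / 6) / (n : ℝ) ^ 3
          - 1 / 8 * Real.log n ^ 3 / (n : ℝ) ^ 4
          - (3 / 4 * K - 5 / 16) * Real.log n ^ 2 / (n : ℝ) ^ 4
          - (3 / 2 * K ^ 2 - 5 / 4 * K + 3 / 8) * Real.log n / (n : ℝ) ^ 4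
          - (K ^ 3 - 5 / 4 * K ^ 2 + 3 / 4 * K - 7 / 48) / (n : ℝ) ^ 4
          + 1 / 16 * Real.log n ^ 4 / (n : ℝ) ^ 5
          + (1 / 2 * K - 13 / 48) * Real.log n ^ 3 / (n : ℝ) ^ 5
          + (3 / 2 * K ^ 2 - 13 / 8 * K + 17 / 32) * Real.log n ^ 2 / (n : ℝ) ^ 5
          + (2 * K ^ 3 - 13 / 4 * K ^ 2 + 17 / 8 * K - 23 / 48) * Real.log n / (n : ℝ) ^ 5
          + (K ^ 4 - 13 / 6 * K ^ 3 + 17 / 8 * K ^ 2 - 23 / 24 * K + 707 / 4320) / (n : ℝ) ^ 5))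
        =O[atTop] fun n : ℕ => Real.log n ^ 5 / (n : ℝ) ^ 6) ∧
    -- `W` and `Z` are kindred
    IterAsymp.HasTaylorStart IterAsymp.lambertW 1 IterAsymp.aW ∧
    IterAsymp.Kindred IterAsymp.lambertW IterAsymp.Z ∧
    -- the patterns of signs
    (∀ i ∈ Finset.Icc 1 5, 0 < IterAsymp.cCoef 1 IterAsymp.aZ i) ∧
    (∀ i ∈ Finset.Icc 1 4,
      IterAsymp.cCoef 1 IterAsymp.aW i * IterAsymp.cCoef 1 IterAsymp.aW (i + 1) < 0) ∧
    (∀ m ∈ Finset.Icc 2 6, IterAsymp.AltCoeffs (IterAsymp.T 1 IterAsymp.aZ m) ∧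
      IterAsymp.SameSignCoeffs (IterAsymp.T 1 IterAsymp.aW m)) ∧
    (∀ m ∈ Finset.Icc 2 6, IterAsymp.PosCoeffs (IterAsymp.P 1 IterAsymp.aZ m) ∧
      IterAsymp.AltCoeffs (IterAsymp.P 1 IterAsymp.aW m)) ∧
    -- the expansion of the iterates of `W`: the same terms, without the alternation of signs
    (∀ x₀ : ℝ, 0 < x₀ → ∃ K : ℝ,
      IterAsymp.Expansion 1 IterAsymp.aW 4 (fun n => IterAsymp.lambertW^[n] x₀) (-K) ∧
      (fun n : ℕ => IterAsymp.lambertW^[n] x₀ -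
        (1 / (n : ℝ)
          + 1 / 2 * Real.log n / (n : ℝ) ^ 2
          + K / (n : ℝ) ^ 2
          + 1 / 4 * Real.log n ^ 2 / (n : ℝ) ^ 3
          + (K - 1 / 4) * Real.log n / (n : ℝ) ^ 3
          + (K ^ 2 - 1 / 2 * K + 1 / 6) / (n : ℝ) ^ 3
          + 1 / 8 * Real.log n ^ 3 / (n : ℝ) ^ 4
          + (3 / 4 * K - 5 / 16) * Real.log n ^ 2 / (n : ℝ) ^ 4
          + (3 / 2 * K ^ 2 - 5 / 4 * K + 3 / 8) * Real.log n / (n : ℝ) ^ 4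
          + (K ^ 3 - 5 / 4 * K ^ 2 + 3 / 4 * K - 7 / 48) / (n : ℝ) ^ 4
          + 1 / 16 * Real.log n ^ 4 / (n : ℝ) ^ 5
          + (1 / 2 * K - 13 / 48) * Real.log n ^ 3 / (n : ℝ) ^ 5
          + (3 / 2 * K ^ 2 - 13 / 8 * K + 17 / 32) * Real.log n ^ 2 / (n : ℝ) ^ 5
          + (2 * K ^ 3 - 13 / 4 * K ^ 2 + 17 / 8 * K - 23 / 48) * Real.log n / (n : ℝ) ^ 5
          + (K ^ 4 - 13 / 6 * K ^ 3 + 17 / 8 * K ^ 2 - 23 / 24 * K + 707 / 4320) / (n : ℝ) ^ 5))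
        =O[atTop] fun n : ℕ => Real.log n ^ 5 / (n : ℝ) ^ 6) := by
  refine ⟨IterAsymp.hasTaylorStart_Z, IterAsymp.lam_aZ, ?_, ?_,
    ⟨IterAsymp.cCoef_aZ_1, IterAsymp.cCoef_aZ_2, IterAsymp.cCoef_aZ_3, IterAsymp.cCoef_aZ_4,
      IterAsymp.cCoef_aZ_5⟩, ⟨IterAsymp.T_one _ _, ?_, ?_, ?_⟩, ⟨?_, ?_, ?_, ?_⟩, ?_,
    IterAsymp.hasTaylorStart_lambertW, IterAsymp.kindred_lambertW_Z, ?_, ?_,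
    fun m hm => ⟨IterAsymp.altCoeffs_T_aZ m hm, IterAsymp.sameSignCoeffs_T_aW m hm⟩,
    fun m hm => ⟨IterAsymp.posCoeffs_P_aZ m hm, IterAsymp.altCoeffs_P_aW m hm⟩, ?_⟩
  · intro j hj
    obtain ⟨h1, h6⟩ := Finset.mem_Icc.1 hj
    interval_cases j <;>
      norm_num [IterAsymp.bCoef_aZ_1, IterAsymp.bCoef_aZ_2, IterAsymp.bCoef_aZ_3,
        IterAsymp.bCoef_aZ_4, IterAsymp.bCoef_aZ_5, IterAsymp.bCoef_aZ_6, Nat.factorial]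
  · intro j hj
    obtain ⟨h1, h6⟩ := Finset.mem_Icc.1 hj
    interval_cases j <;>
      norm_num [IterAsymp.aCoef_aZ_0_1, IterAsymp.aCoef_aZ_0_2, IterAsymp.aCoef_aZ_0_3,
        IterAsymp.aCoef_aZ_0_4, IterAsymp.aCoef_aZ_0_5, IterAsymp.aCoef_aZ_0_6]
  · refine Polynomial.funext fun x => ?_
    simp [IterAsymp.eval_T_aZ_2]
  · refine Polynomial.funext fun x => ?_
    simp [IterAsymp.eval_T_aZ_3]
  · refine Polynomial.funext fun x => ?_
    simp [IterAsymp.eval_T_aZ_4]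
  · refine Polynomial.funext fun x => ?_
    simp [IterAsymp.eval_P_aZ_1]
  · refine Polynomial.funext fun x => ?_
    simp [IterAsymp.eval_P_aZ_2]
  · refine Polynomial.funext fun x => ?_
    simp [IterAsymp.eval_P_aZ_3]
  · refine Polynomial.funext fun x => ?_
    simp [IterAsymp.eval_P_aZ_4]
  · intro x₀ hx₀
    obtain ⟨K, hK⟩ := IterAsymp.iterate_Z_sub_homSum_isBigO hx₀
    -- One K serves both forms, since each rewrites the same `homSum` estimate.
    refine ⟨K, IterAsymp.expansion_aZ hK, hK.congr_left fun n => ?_⟩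
    rw [IterAsymp.homSum]
    ring
  · intro i hi
    obtain ⟨h1, h5⟩ := Finset.mem_Icc.1 hi
    interval_cases i <;>
      norm_num [IterAsymp.cCoef_aZ_1, IterAsymp.cCoef_aZ_2, IterAsymp.cCoef_aZ_3,
        IterAsymp.cCoef_aZ_4, IterAsymp.cCoef_aZ_5]
  · intro i hi
    obtain ⟨h1, h4⟩ := Finset.mem_Icc.1 hi
    interval_cases i <;>
      norm_num [IterAsymp.cCoef_aW_1, IterAsymp.cCoef_aW_2, IterAsymp.cCoef_aW_3,
        IterAsymp.cCoef_aW_4, IterAsymp.cCoef_aW_5]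
  · intro x₀ hx₀
    obtain ⟨K, hK⟩ := IterAsymp.iterate_lambertW_sub_homSum_isBigO hx₀
    refine ⟨K, IterAsymp.expansion_aW hK, hK.neg_left.congr_left fun n => ?_⟩
    rw [IterAsymp.homSum]
    ring
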